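/- **Setting.** Fix a real number $\alpha>1$ and a sequence of positive integers $\sigma_1,\sigma_2,\dots$ (layer sizes) with $\sigma_1=1$ and $\lim_{u\to\infty}\sigma_{u+1}/\sigma_u=\alpha$. A *layer-ordered heap* (LOH) of a vector $X$ is a partition of its entries into layers $X^{(1)},X^{(2)},\dots$ with $|X^{(u)}|=\sigma_u$, except that the last layer is cut off at the length of $X$, such that every entry of a layer is $\le$ every entry of the next. A *layer product* $X^{(u)}+Y^{(v)}$ consists of the $|X^{(u)}|\cdot|Y^{(v)}|$ values $x+y$ with $x\in X^{(u)}$, $y\in Y^{(v)}$. Its *corners* are the tuples $\lfloor(u,v)\rfloor=(\min(X^{(u)}+Y^{(v)}),(u,v),0)$ and $\lceil(u,v)\rceil=(\max(X^{(u)}+Y^{(v)}),(u,v),1)$; corners are ordered lexicographically. **Algorithm.** The input is two real vectors $X,Y$ and an integer $k$ with $1\le k\le |X|\cdot|Y|$. * *Phase 0:* build LOHs of $X$ and of $Y$ by iteratively selecting and removing the largest remaining layer with linear-time (median-of-medians) selection, and record the size, minimum and maximum of each layer. * *Phase 1:* keep a binary heap $H$ of corners, together with the set of the tuples in $H$ (by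 which duplicate insertions are avoided), initially containing $\lfloor(1,1)\rfloor$. Put $s=0$ and let $q$ be empty. While $s<k$, pop the minimum of $H$. If it is $\lfloor(u,v)\rfloor$, insert $\lfloor(u+1,v)\rfloor$, $\lfloor(u,v+1)\rfloor$ (if these layer products exist) and $\lceil(u,v)\rceil$ into $H$, unless already there. If it is $\lceil(u,v)\rceil$, append $(u,v)$ to $q$ and add $|X^{(u)}|\cdot|Y^{(v)}|$ to $s$. * *Phase 2:* append to $q$ the index of every corner $\lceil(u',v')\rceil$ still in $H$; let $s'$ be the total size of these layer products. * *Phase 3:* generate all values of all layer products in $q$ and select the $k$ smallest by linear-time (median-of-medians) selection. Time is the number of unit-cost steps: a function call (a round of a loop or recursion) with a bounded number of list, tree, record or array-cell operations, comparisons and arithmetic operations on entries and integers, and evaluations of $\sigma$ costs one step. **Theorem.** There is a constant $C$, depending only on the sequence $\sigma$, such that for all real vectors $X,Y$ and all integers $k$ with $1\le k\le|X|\cdot|Y|$: 1. the algorithm returns the $k$ smallest values of $X+Y$ (with multiplicities) in at most $C(|X|+|Y|+k)$ steps; in particular, its running time is $O(n+k)$ if $|X|=|Y|=n$; 2. phase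 0 takes at most $C(|X|+|Y|)$ steps; 3. at most $C(1+\log|X|)(1+\log|Y|)$ corners are inserted into $H$ in phases 1 and 2; 4. at the end of phase 1, the layer products in $q$ have $s\ge k$ elements in total; at the end of phase 2, those in $q$ have $s+s'\le Ck$ elements in total; and phase 3 takes at most $Ck$ steps. Moreover, phases 1 and 2 take $o(|X|+|Y|)$ steps, uniformly in $k$: for every $\varepsilon>0$ there is an $N$ such that, for all $X,Y,k$ as above with $|X|+|Y|\ge N$, phases 1 and 2 together take at most $\varepsilon(|X|+|Y|)$ steps. -/

import Mathlib

/-!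
The cost model.  A computation returns a value together with the number of steps it took.
Everything below is first-order code over lists, binary trees and arrays.  Every call of a
function of the algorithm, and every round of a loop or recursion, is charged one step by `tick`;
between two ticks only a bounded number of constant-time operations is carried out: building or
inspecting one list cell, tree node, record or tuple, one array read or one array push, one
evaluation of the layer-size sequence, and comparisons and arithmetic operations on single entries
and natural numbers.

Fuel arguments (always named `fuel`) only make the recursions visibly terminating.
-/

namespace LOH

/-- A value together with the number of steps spent on computing it. -/
structure Cost (β : Type) where
  val : β
  steps : ℕ

instance : Monad Cost where
  pure x := ⟨x, 0⟩
  bind c f := ⟨(f c.val).val, c.steps + (f c.val).steps⟩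

/-- Spend one step. -/
def tick : Cost Unit := ⟨(), 1⟩

section Lists

variable {R : Type}

/-- Length of a list. -/
def length : List R → Cost ℕ
  | [] => do tick; return 0
  | _ :: t => do
    tick
    let n ← length t
    return n + 1

/-- Concatenation of two lists. -/
def append : List R → List R → Cost (List R)
  | [], m => do tick; return m
  | a :: t, m => do
    tick
    let r ← append t m
    return a :: r

/-- The `i`-th entry of a list (counted from `0`). -/
def nth : ℕ → List R → Cost (Option R)
  | _, [] => do tick; return none
  | 0, a :: _ => do tick; return some a
  | i + 1, _ :: t => do tick; nth i t

/-- The first `i` entries of a list and the others. -/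
def splitAt : ℕ → List R → Cost (List R × List R)
  | 0, l => do tick; return ([], l)
  | _ + 1, [] => do tick; return ([], [])
  | i + 1, a :: t => do
    tick
    let (l, r) ← splitAt i t
    return (a :: l, r)

end Lists

section Selection

/-! One-dimensional selection in linear time by median of medians. -/

variable {R : Type} [LinearOrder R]

/-- Insert an entry into a sorted list. -/
def insertSorted (a : R) : List R → Cost (List R)
  | [] => do tick; return [a]
  | b :: t => do
    tick
    if a ≤ b then return a :: b :: t
    else
      let r ← insertSorted a t
      return b :: r

/-- Insertion sort; used on lists of bounded length only. -/
def insertionSort : List R → Cost (List R)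
  | [] => do tick; return []
  | a :: t => do
    tick
    let r ← insertionSort t
    insertSorted a r

/-- The medians of consecutive groups of five; an incomplete last group is left out. -/
def medians : List R → Cost (List R)
  | a :: b :: c :: d :: e :: t => do
    tick
    let s ← insertionSort [a, b, c, d, e]
    let ms ← medians t
    match s with
    | _ :: _ :: m :: _ => return m :: ms
    | _ => return ms
  | _ => do tick; return []

/-- The entries less than, equal to, and greater than the pivot `p`. -/
def partition (p : R) : List R → Cost (List R × List R × List R)
  | [] => do tick; return ([], [], [])
  | a :: t => do
    tick
    let (lt, eq, gt) ← partition p t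
    if a < p then return (a :: lt, eq, gt)
    else if p < a then return (lt, eq, a :: gt)
    else return (lt, a :: eq, gt)

/-- The entry of rank `i` (counted from `0`) of a list, by median of medians. -/
def select : (fuel : ℕ) → (i : ℕ) → List R → Cost (Option R)
  | 0, _, _ => do tick; return none
  | fuel + 1, i, l => do
    tick
    let n ← length l
    if n ≤ 100 then
      let s ← insertionSort l
      nth i s
    else
      let ms ← medians l
      let g ← length ms
      match ← select fuel (g / 2) ms with
      | none => return none
      | some p =>
        let (lt, eq, gt) ← partition p l
        let a ← length lt
        let b ← length eq
        if i < a then select fuel i lt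
        else if i < a + b then return some p
        else select fuel (i - a - b) gt

/-- Split a list into its `k` smallest entries and the others (linear-time `k`-selection). -/
def smallest (k : ℕ) (l : List R) : Cost (List R × List R) := do
  tick
  if k = 0 then return ([], l)
  else
    let n ← length l
    match ← select n (k - 1) l with
    | none => return (l, [])
    | some p =>
      let (lt, eq, gt) ← partition p l
      let a ← length lt
      let (eq1, eq2) ← splitAt (k - a) eq
      let small ← append lt eq1
      let large ← append eq2 gt
      return (small, large)

end Selection

section Layers

/-! Construction of a layer-ordered heap. -/

variable {R : Type}

/-- A layer, with its number of entries, its minimum and its maximum. -/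
structure Layer (R : Type) where
  entries : List R
  size : ℕ
  lo : R
  hi : R

/-- The positions at which the layers of a vector of length `n` start, last layer first: the
layer with index `u` has `σ u` entries, except that the last layer is cut off at `n`.
Here `u` is the next layer, `c` its start, and `acc` holds the starts of the earlier ones. -/
def layerStarts (σ : ℕ → ℕ) (n : ℕ) :
    (fuel : ℕ) → (u c : ℕ) → (acc : List ℕ) → Cost (List ℕ)
  | 0, _, _, acc => do tick; return acc
  | fuel + 1, u, c, acc => do
    tick
    if c < n then layerStarts σ n fuel (u + 1) (c + σ u) (c :: acc)
    else return acc

variable [LinearOrder R]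

/-- Iteratively select and remove the largest remaining layer. -/
def peel : (starts : List ℕ) → List R → (acc : List (List R)) → Cost (List (List R))
  | [], _, acc => do tick; return acc
  | c :: cs, l, acc => do
    tick
    let (small, large) ← smallest c l
    peel cs small (large :: acc)

/-- Size, minimum and maximum of a list, given those of the part already read. -/
def scan : List R → (size : ℕ) → (lo hi : R) → Cost (ℕ × R × R)
  | [], m, lo, hi => do tick; return (m, lo, hi)
  | a :: t, m, lo, hi => do
    tick
    scan t (m + 1) (min lo a) (max hi a)

/-- Store the layers, with their sizes, minima and maxima, in an array. -/
def store : List (List R) → (acc : Array (Layer R)) → Cost (Array (Layer R))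
  | [], acc => do tick; return acc
  | [] :: ls, acc => do tick; store ls acc
  | (a :: t) :: ls, acc => do
    tick
    let (m, lo, hi) ← scan t 1 a a
    store ls (acc.push ⟨a :: t, m, lo, hi⟩)

/-- The layer-ordered heap of a vector, as the array of its layers. -/
def lohify (σ : ℕ → ℕ) (X : List R) : Cost (Array (Layer R)) := do
  tick
  let n ← length X
  let starts ← layerStarts σ n (n + 1) 0 0 []
  let ls ← peel starts X []
  store ls #[]

end Layers

section Heap

/-! Binary heaps, as balanced (Braun) trees: the left subtree of every node has as many nodes as
the right one, or one more. -/

/-- Binary trees with labelled nodes. -/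
inductive Tree (β : Type) where
  | leaf : Tree β
  | node : Tree β → β → Tree β → Tree β

variable {β : Type}

/-- The label of the root. -/
def Tree.root : Tree β → Option β
  | .leaf => none
  | .node _ x _ => some x

/-- Remove some node of a tree, keeping the balance. -/
def Tree.removeLeft : Tree β → Cost (Option (β × Tree β))
  | .leaf => do tick; return none
  | .node l x r => do
    tick
    match ← l.removeLeft with
    | none => return some (x, r)
    | some (y, l1) => return some (y, .node r x l1)

variable [LinearOrder β]

/-- Insert an element into a binary heap. -/
def Tree.push : β → Tree β → Cost (Tree β)
  | a, .leaf => do tick; return .node .leaf a .leaf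
  | a, .node l x r => do
    tick
    if a ≤ x then
      let r1 ← r.push x
      return .node r1 a l
    else
      let r1 ← r.push a
      return .node r1 x l

/-- Replace the label of the root by `a` and let it sink to its place. -/
def Tree.sink (a : β) : Tree β → Cost (Tree β)
  | .leaf => do tick; return .node .leaf a .leaf
  | .node l _ r => do
    tick
    match l.root, r.root with
    | none, none => return .node l a r
    | some x, none =>
      if a ≤ x then return .node l a r
      else
        let l1 ← l.sink a
        return .node l1 x r
    | none, some y =>
      if a ≤ y then return .node l a r
      else
        let r1 ← r.sink a
        return .node l y r1
    | some x, some y =>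
      if a ≤ x ∧ a ≤ y then return .node l a r
      else if x ≤ y then
        let l1 ← l.sink a
        return .node l1 x r
      else
        let r1 ← r.sink a
        return .node l y r1

/-- Pop the minimum of a binary heap. -/
def Tree.pop : Tree β → Cost (Option (β × Tree β))
  | .leaf => do tick; return none
  | .node l x r => do
    tick
    match ← l.removeLeft with
    | none => return some (x, r)
    | some (y, l1) =>
      let t ← (Tree.node r x l1).sink y
      return some (x, t)

end Heap

section KeySet

/-! Sets of natural numbers, as binary tries: the number `0` belongs to the root, the odd numbers
`2 m + 1` to the left subtrie as `m`, the even numbers `2 m + 2` to the right subtrie as `m`. -/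

/-- Sets of natural numbers. -/
inductive KeySet where
  | empty : KeySet
  | node : (here : Bool) → KeySet → KeySet → KeySet

/-- Membership test. -/
def KeySet.mem : ℕ → KeySet → Cost Bool
  | _, .empty => do tick; return false
  | k, .node b l r => do
    tick
    if k = 0 then return b
    else if k % 2 = 1 then l.mem ((k - 1) / 2)
    else r.mem ((k - 1) / 2)

/-- Insert (`b = true`) or delete (`b = false`) the number `k`. -/
def KeySet.write (b : Bool) (k : ℕ) (t : KeySet) : Cost KeySet := do
  tick
  let (c, l, r) := match t with
    | .empty => (false, KeySet.empty, KeySet.empty)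
    | .node c l r => (c, l, r)
  if k = 0 then return .node b l r
  else if k % 2 = 1 then
    let l1 ← KeySet.write b ((k - 1) / 2) l
    return .node c l1 r
  else
    let r1 ← KeySet.write b ((k - 1) / 2) r
    return .node c l r1
termination_by k
decreasing_by all_goals omega

end KeySet

section TopK

/-! Selection on `X + Y`.  Layers are indexed from `0`, so the first layer product is `(0, 0)`. -/

variable {R : Type} [LinearOrder R]

/-- A corner of the layer product `(u, v)`: the tuple of its minimum or maximum value, the index
`(u, v)`, and whether it is the maximum.  Corners are ordered lexicographically. -/
abbrev Corner (R : Type) : Type := R ×ₗ ((ℕ ×ₗ ℕ) ×ₗ Bool)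

/-- The corner with value `x`, index `(u, v)` and flag `isMax`. -/
def corner (x : R) (u v : ℕ) (isMax : Bool) : Corner R :=
  toLex (x, toLex (toLex (u, v), isMax))

/-- The index of a corner. -/
def Corner.index (c : Corner R) : ℕ × ℕ := ofLex (ofLex (ofLex c).2).1

/-- Whether a corner is a maximum. -/
def Corner.isMax (c : Corner R) : Bool := (ofLex (ofLex c).2).2

/-- The number that represents, in the set of the tuples in the heap, a corner of the layer
product `(u, v)`, when the second vector has `m` layers. -/
def key (m u v : ℕ) (isMax : Bool) : ℕ := 2 * (u * m + v) + (if isMax then 1 else 0)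

/-- The state of phase 1. -/
structure State (R : Type) where
  /-- the binary heap `H` -/
  heap : Tree (Corner R)
  /-- the set of all tuples in `H` -/
  inHeap : KeySet
  /-- the list of the indices of the layer products whose maximum has been popped -/
  q : List (ℕ × ℕ)
  /-- the total size of the layer products in `q` -/
  s : ℕ
  /-- how many tuples have been inserted into `H` so far -/
  corners : ℕ

/-- The size of the layer product with index `p`. -/
def productSize (A B : Array (Layer R)) (p : ℕ × ℕ) : Cost ℕ := do
  tick
  match A[p.1]?, B[p.2]? with
  | some a, some b => return a.size * b.size
  | _, _ => return 0

variable [Add R]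

/-- Insert the minimum or maximum corner of the layer product `(u, v)` into the heap, unless there
is no such layer product or the corner is already in the heap. -/
def insertCorner (A B : Array (Layer R)) (u v : ℕ) (isMax : Bool) (st : State R) :
    Cost (State R) := do
  tick
  match A[u]?, B[v]? with
  | some a, some b =>
    let i := key B.size u v isMax
    let present ← st.inHeap.mem i
    if present then return st
    else
      let x := if isMax then a.hi + b.hi else a.lo + b.lo
      let heap ← st.heap.push (corner x u v isMax)
      let inHeap ← st.inHeap.write true i
      return { st with heap := heap, inHeap := inHeap, corners := st.corners + 1 }
  | _, _ => return st

/-- Process the corner `c` that has just been popped, leaving the heap `heap`. -/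
def process (A B : Array (Layer R)) (c : Corner R) (heap : Tree (Corner R)) (st : State R) :
    Cost (State R) := do
  tick
  let (u, v) := Corner.index c
  let inHeap ← st.inHeap.write false (key B.size u v (Corner.isMax c))
  let st1 := { st with heap := heap, inHeap := inHeap }
  if Corner.isMax c then
    let m ← productSize A B (u, v)
    return { st1 with q := (u, v) :: st1.q, s := st1.s + m }
  else
    let st2 ← insertCorner A B (u + 1) v false st1
    let st3 ← insertCorner A B u (v + 1) false st2
    insertCorner A B u v true st3

/-- Pop corners until the layer products in `q` have at least `k` elements. -/
def popLoop (A B : Array (Layer R)) (k : ℕ) : (fuel : ℕ) → State R → Cost (State R)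
  | 0, st => do tick; return st
  | fuel + 1, st => do
    tick
    if k ≤ st.s then return st
    else
      match ← st.heap.pop with
      | none => return st
      | some (c, heap) =>
        let st1 ← process A B c heap st
        popLoop A B k fuel st1

/-- Append the indices of all maximum corners in the heap to `q`, and add up the sizes of their
layer products; `acc` is the pair of the current `q` and the current total. -/
def collect (A B : Array (Layer R)) :
    Tree (Corner R) → (acc : List (ℕ × ℕ) × ℕ) → Cost (List (ℕ × ℕ) × ℕ)
  | .leaf, acc => do tick; return acc
  | .node l c r, acc => do
    tick
    let acc1 ← collect A B l acc
    let acc2 ← collect A B r acc1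
    if Corner.isMax c then
      let m ← productSize A B (Corner.index c)
      return (Corner.index c :: acc2.1, acc2.2 + m)
    else return acc2

/-- Prepend all values `x + y`, `y` in a list, to `acc`. -/
def addRow (x : R) : List R → (acc : List R) → Cost (List R)
  | [], acc => do tick; return acc
  | y :: t, acc => do tick; addRow x t ((x + y) :: acc)

/-- Prepend all values `x + y`, `x` and `y` in given lists, to `acc`. -/
def addProduct (l m : List R) (acc : List R) : Cost (List R) :=
  match l with
  | [] => do tick; return acc
  | x :: t => do
    tick
    let acc1 ← addRow x m acc
    addProduct t m acc1

/-- Prepend the values of all elements of the layer products with indices in `q` to `acc`. -/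
def candidates (A B : Array (Layer R)) : (q : List (ℕ × ℕ)) → (acc : List R) → Cost (List R)
  | [], acc => do tick; return acc
  | (u, v) :: q, acc => do
    tick
    match A[u]?, B[v]? with
    | some a, some b =>
      let acc1 ← addProduct a.entries b.entries acc
      candidates A B q acc1
    | _, _ => candidates A B q acc

/-- Phase 0: build the layer-ordered heaps of both vectors. -/
def phase0 (σ : ℕ → ℕ) (X Y : List R) : Cost (Array (Layer R) × Array (Layer R)) := do
  tick
  let A ← lohify σ X
  let B ← lohify σ Y
  return (A, B)

/-- Phase 1: starting from the minimum corner of the first layer product, pop corners until the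
layer products in `q` have at least `k` elements.  (There are `2 |A| |B|` corners.) -/
def phase1 (A B : Array (Layer R)) (k : ℕ) : Cost (State R) := do
  tick
  let st ← insertCorner A B 0 0 false ⟨.leaf, .empty, [], 0, 0⟩
  popLoop A B k (2 * A.size * B.size + 1) st

/-- Phase 2: append the layer products whose maximum corner remains in the heap to `q`.  Returns
the final `q`, and the number `s'` of elements of the layer products appended here. -/
def phase2 (A B : Array (Layer R)) (st : State R) : Cost (List (ℕ × ℕ) × ℕ) := do
  tick
  collect A B st.heap (st.q, 0)

/-- Phase 3: generate all values of the layer products in `q` and select the `k` smallest. -/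
def phase3 (A B : Array (Layer R)) (q : List (ℕ × ℕ)) (k : ℕ) : Cost (List R) := do
  tick
  let l ← candidates A B q []
  let (small, _) ← smallest k l
  return small

/-- The algorithm: the `k` smallest values of `X + Y` by layer-ordered heaps whose layers have
sizes `σ 0, σ 1, …`. -/
def topK (σ : ℕ → ℕ) (X Y : List R) (k : ℕ) : Cost (List R) := do
  tick
  let (A, B) ← phase0 σ X Y
  let st ← phase1 A B k
  let (q, _) ← phase2 A B st
  phase3 A B q k

/-- All `|X| |Y|` values `x + y`, with multiplicities. -/
def sums (X Y : List R) : List R := X.flatMap fun x => Y.map fun y => x + y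

/-- `out` consists of the `k` smallest values of `X + Y`, counted with multiplicities, in some
order. -/
def IsTopK (k : ℕ) (X Y out : List R) : Prop :=
  out.length = k ∧
    ∃ rest : List R, (out ++ rest).Perm (sums X Y) ∧ ∀ a ∈ out, ∀ b ∈ rest, a ≤ b

/-- The number of elements of all layer products with indices in `q` together. -/
def totalSize (A B : Array (Layer R)) (q : List (ℕ × ℕ)) : ℕ :=
  (q.map fun p => (A[p.1]?.elim 0 fun a => a.entries.length) *
    (B[p.2]?.elim 0 fun b => b.entries.length)).sum

/-- `σ` is a sequence of layer sizes with growth ratio `α`: the first layer has one element, no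
layer is empty, and the ratio of consecutive sizes tends to `α`. -/
structure IsLayerSizes (α : ℝ) (σ : ℕ → ℕ) : Prop where
  first : σ 0 = 1
  pos : ∀ u, 0 < σ u
  ratio : Filter.Tendsto (fun u => (σ (u + 1) : ℝ) / (σ u : ℝ)) Filter.atTop (nhds α)

end TopK

end LOH

namespace LOH

/-! ### Value and step count of the cost monad -/

section CostLemmas

variable {β γ : Type}

/-! Let `P` be the set of corners popped so far and `H` the set of corners in the heap. Phase 1
keeps every element of `P` strictly below every element of `H`, and every corner outside `P` has an
element of `H` at or below it (`Invariant.exists_le`). So `P` is a lower set among all corners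
(`Invariant.mem_of_lt`), no corner enters the heap twice, and the loop cannot run dry before `k`
elements are reached. A maximum corner lies in `P ∪ H` exactly when the minimum corner of the same
product lies in `P`; hence after phase 2 the list `q` consists of the products whose minimum has
been popped.

Correctness (`Invariant.isTopK`): let `T` be the value of the last popped corner, the maximum of a
product `(u, v)`. The products counted by `s` supply at least `k` sums that are at most `T`, so the
`k` smallest candidates are at most `T`. A product missing from `q` has an unpopped minimum, so all
its sums are at least `T`.

Number of candidates (`Invariant.sum_le`): the maximum corner of the diagonal predecessor `(a - 1, b
- 1)` lies strictly below the minimum corner of `(a, b) ≠ (0, 0)`. With truncated subtraction this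
also holds on the boundary, because the first layer has one entry. So the predecessor of every
product in `q` other than `(0, 0)` had its maximum popped, and popped before that of `(u, v)`. The
predecessors thus lie among products with fewer than `k` elements in total, each has at most four
successors, and one step along the diagonal multiplies the size by at most `M ^ 2`, where `M` bounds
the ratios of consecutive layers. This gives at most `(1 + 4 * M ^ 2) * k` candidates, and phase 3
is linear in them.

Time of the other phases: since `α > 1`, the first `u + 1` layers together are at most a constant
times the last of them. Hence the selections of phase 0 form a geometrically dominated sum, and a
vector of length `n` has `O(1 + log n)` layers. Phases 1 and 2 cost at most a quadratic polynomial
in the number of corners, even if every heap or set operation is charged the total number of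
corners; this is polylogarithmic, hence `o(n)`. -/

@[simp] theorem Cost.val_pure (x : β) : (pure x : Cost β).val = x := rfl

@[simp] theorem Cost.steps_pure (x : β) : (pure x : Cost β).steps = 0 := rfl

@[simp] theorem Cost.val_bind (c : Cost β) (f : β → Cost γ) : (c >>= f).val = (f c.val).val := rfl

@[simp] theorem Cost.steps_bind (c : Cost β) (f : β → Cost γ) :
    (c >>= f).steps = c.steps + (f c.val).steps := rfl

@[simp] theorem val_tick : tick.val = () := rfl

@[simp] theorem steps_tick : tick.steps = 1 := rfl

end CostLemmas

/-! ### Elementary list functions -/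

section ListFunctions

variable {R : Type}

@[simp] theorem val_length (l : List R) : (length l).val = l.length := by
  induction l with
  | nil => rfl
  | cons a t ih => simp [length, ih]

@[simp] theorem steps_length (l : List R) : (length l).steps = l.length + 1 := by
  induction l with
  | nil => rfl
  | cons a t ih => simp [length, ih]; omega

@[simp] theorem val_append (l m : List R) : (append l m).val = l ++ m := by
  induction l with
  | nil => rfl
  | cons a t ih => simp [append, ih]

@[simp] theorem steps_append (l m : List R) : (append l m).steps = l.length + 1 := by
  induction l with
  | nil => rfl
  | cons a t ih => simp [append, ih]; omega

@[simp] theorem val_nth (i : ℕ) (l : List R) : (nth i l).val = l[i]? := by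
  induction l generalizing i with
  | nil => cases i <;> rfl
  | cons a t ih => cases i <;> simp [nth, ih]

theorem steps_nth_le (i : ℕ) (l : List R) : (nth i l).steps ≤ l.length + 1 := by
  induction l generalizing i with
  | nil => cases i <;> simp [nth]
  | cons a t ih =>
    cases i with
    | zero => simp [nth]
    | succ i => have := ih i; simp [nth]; omega

@[simp] theorem val_splitAt (i : ℕ) (l : List R) : (splitAt i l).val = (l.take i, l.drop i) := by
  induction l generalizing i with
  | nil => cases i <;> simp [splitAt]
  | cons a t ih => cases i <;> simp [splitAt, ih]

theorem steps_splitAt_le (i : ℕ) (l : List R) : (splitAt i l).steps ≤ l.length + 1 := by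
  induction l generalizing i with
  | nil => cases i <;> simp [splitAt]
  | cons a t ih =>
    cases i with
    | zero => simp [splitAt]
    | succ i => have := ih i; simp [splitAt]; omega

end ListFunctions

/-! ### Linear-time selection by median of medians -/

section SelectionLemmas

variable {R : Type} [LinearOrder R]

theorem val_insertSorted (a : R) (l : List R) :
    (insertSorted a l).val = l.orderedInsert (· ≤ ·) a := by
  induction l with
  | nil => rfl
  | cons b t ih =>
    by_cases h : a ≤ b <;> simp [insertSorted, h, ih]

theorem steps_insertSorted_le (a : R) (l : List R) :
    (insertSorted a l).steps ≤ l.length + 1 := by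
  induction l with
  | nil => simp [insertSorted]
  | cons b t ih =>
    by_cases h : a ≤ b <;> simp [insertSorted, h]; omega

theorem val_insertionSort (l : List R) :
    (insertionSort l).val = l.insertionSort (· ≤ ·) := by
  induction l with
  | nil => rfl
  | cons b t ih => simp [insertionSort, ih, val_insertSorted]

theorem steps_insertionSort_le (l : List R) :
    (insertionSort l).steps ≤ l.length * (l.length + 1) + 1 := by
  induction l with
  | nil => simp [insertionSort]
  | cons b t ih =>
    have h := steps_insertSorted_le b (t.insertionSort (· ≤ ·))
    simp only [List.length_insertionSort] at h
    simp only [insertionSort, Cost.steps_bind, steps_tick, val_insertionSort, List.length_cons]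
    nlinarith

theorem val_partition (p : R) (l : List R) :
    (partition p l).val = (l.filter (· < p), l.filter (· = p), l.filter (p < ·)) := by
  induction l with
  | nil => rfl
  | cons a t ih =>
    rcases lt_trichotomy a p with h | h | h
    · simp [partition, ih, h, h.ne, not_lt.2 h.le]
    · simp [partition, ih, h]
    · simp [partition, ih, h, h.ne', not_lt.2 h.le]

@[simp] theorem steps_partition (p : R) (l : List R) : (partition p l).steps = l.length + 1 := by
  induction l with
  | nil => rfl
  | cons a t ih =>
    simp only [partition, Cost.steps_bind, steps_tick, ih, List.length_cons]
    split_ifs <;> simp <;> omega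

theorem length_filter_trichotomy (p : R) (l : List R) :
    (l.filter (· < p)).length + (l.filter (· = p)).length + (l.filter (p < ·)).length
      = l.length := by
  induction l with
  | nil => rfl
  | cons a t ih =>
    rcases lt_trichotomy a p with h | h | h
    · simp [h, h.ne, not_lt.2 h.le]; omega
    · simp [h]; omega
    · simp [h, h.ne', not_lt.2 h.le]; omega

/-- `p` has rank `i` (counted from `0`) in `l`. -/
def HasRank (i : ℕ) (l : List R) (p : R) : Prop :=
  l.countP (· < p) ≤ i ∧ i < l.countP (· ≤ p)

theorem HasRank.perm {i : ℕ} {l m : List R} {p : R} (h : HasRank i l p) (e : l.Perm m) :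
    HasRank i m p := by
  simpa only [HasRank, e.countP_eq] using h

/-- Cut the sorted list at position `i`: only the `i` entries before the cut can be below `p`, and
these together with `p` itself are `i + 1` entries that are at most `p`. -/
theorem hasRank_of_pairwise {i : ℕ} {l : List R} {p : R} (h : l.Pairwise (· ≤ ·))
    (hp : l[i]? = some p) : HasRank i l p := by
  obtain ⟨hi, rfl⟩ := List.getElem?_eq_some_iff.1 hp
  have e : l = l.take i ++ l[i] :: l.drop (i + 1) := by simp
  have h' := e ▸ h
  rw [List.pairwise_append] at h'
  obtain ⟨-, h2, h3⟩ := h'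
  rw [List.pairwise_cons] at h2
  have hlen : (l.take i).length = i := by simp; omega
  generalize l[i] = p at *
  generalize l.take i = l₁ at *
  generalize l.drop (i + 1) = l₂ at *
  subst e
  constructor
  · rw [List.countP_append, (List.countP_eq_zero (l := p :: l₂)).2]
    · exact hlen ▸ List.countP_le_length
    · simpa using h2.1
  · rw [List.countP_append, (List.countP_eq_length (l := l₁)).2, List.countP_cons]
    · simp; omega
    · intro a ha
      simpa using h3 a ha p (by simp)

theorem HasRank.mem {i : ℕ} {l : List R} {p : R} (h : HasRank i l p) : p ∈ l := by
  by_contra hp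
  have : l.countP (· < p) = l.countP (· ≤ p) := by
    apply List.countP_congr
    intro a ha
    have : a ≠ p := fun e => hp (e ▸ ha)
    simpa using ⟨le_of_lt, fun h => lt_of_le_of_ne h this⟩
  unfold HasRank at h
  omega

theorem exists_hasRank_insertionSort {i : ℕ} {l : List R} (h : i < l.length) :
    ∃ p, (l.insertionSort (· ≤ ·))[i]? = some p ∧ HasRank i l p := by
  have hi : i < (l.insertionSort (· ≤ ·)).length := by simpa using h
  refine ⟨_, List.getElem?_eq_getElem hi, ?_⟩
  exact (hasRank_of_pairwise (List.pairwise_insertionSort _ l)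
    (List.getElem?_eq_getElem hi)).perm (List.perm_insertionSort _ l)

/-- Three of five entries are bounded by their median, and three bound it. -/
theorem exists_median (a b c d e : R) :
    ∃ s₀ s₁ m s₃ s₄, [a, b, c, d, e].insertionSort (· ≤ ·) = [s₀, s₁, m, s₃, s₄] ∧
      (∀ p, m ≤ p → 3 ≤ [a, b, c, d, e].countP (· ≤ p)) ∧
      (∀ p, p ≤ m → 3 ≤ [a, b, c, d, e].countP (p ≤ ·)) := by
  have hlen : ([a, b, c, d, e].insertionSort (· ≤ ·)).length = 5 :=
    List.length_insertionSort _ _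
  have hs := List.pairwise_insertionSort (· ≤ ·) [a, b, c, d, e]
  have hp := List.perm_insertionSort (· ≤ ·) [a, b, c, d, e]
  generalize [a, b, c, d, e].insertionSort (· ≤ ·) = s at hlen hs hp
  match s, hlen with
  | [s₀, s₁, m, s₃, s₄], _ =>
    refine ⟨s₀, s₁, m, s₃, s₄, rfl, fun p h => ?_, fun p h => ?_⟩
    · rw [← hp.countP_eq]
      simp at hs
      have h0 : s₀ ≤ p := hs.1.2.1.trans h
      have h1 : s₁ ≤ p := hs.2.1.1.trans h
      simp [List.countP_cons, h0, h1, h]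
    · rw [← hp.countP_eq]
      simp at hs
      have h3 : p ≤ s₃ := h.trans hs.2.2.1.1
      have h4 : p ≤ s₄ := h.trans hs.2.2.1.2
      simp [List.countP_cons, h3, h4, h]
      omega

theorem val_medians_cons (a b c d e : R) (t : List R) :
    ∃ m, (medians (a :: b :: c :: d :: e :: t)).val = m :: (medians t).val ∧
      (∀ p, m ≤ p → 3 ≤ [a, b, c, d, e].countP (· ≤ p)) ∧
      (∀ p, p ≤ m → 3 ≤ [a, b, c, d, e].countP (p ≤ ·)) := by
  obtain ⟨s₀, s₁, m, s₃, s₄, hs, h⟩ := exists_median a b c d e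
  exact ⟨m, by simp only [medians, Cost.val_bind, val_insertionSort, hs, Cost.val_pure], h⟩

theorem steps_medians_cons_le (a b c d e : R) (t : List R) :
    (medians (a :: b :: c :: d :: e :: t)).steps ≤ (medians t).steps + 32 := by
  obtain ⟨s₀, s₁, m, s₃, s₄, hs, h⟩ := exists_median a b c d e
  have := steps_insertionSort_le [a, b, c, d, e]
  simp only [medians, Cost.steps_bind, val_insertionSort, hs, Cost.steps_pure, steps_tick]
  simp at this
  omega

theorem medians_of_length_lt {l : List R} (h : l.length < 5) : medians l = ⟨[], 1⟩ := by
  match l, h with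
  | [], _ => rfl
  | [_], _ => rfl
  | [_, _], _ => rfl
  | [_, _, _], _ => rfl
  | [_, _, _, _], _ => rfl
  | _ :: _ :: _ :: _ :: _ :: _, h => simp at h; omega

/-- Induction on a list in steps of five entries. -/
theorem five_induction {R : Type} {P : List R → Prop} (short : ∀ l, l.length < 5 → P l)
    (step : ∀ a b c d e t, P t → P (a :: b :: c :: d :: e :: t)) (l : List R) : P l := by
  induction h : l.length using Nat.strong_induction_on generalizing l with
  | _ n ih =>
    match l, h with
    | [], _ | [_], _ | [_, _], _ | [_, _, _], _ | [_, _, _, _], _ => exact short _ (by simp)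
    | a :: b :: c :: d :: e :: t, h =>
      exact step a b c d e t (ih t.length (by simp at h; omega) t rfl)

theorem medians_spec (l : List R) :
    (medians l).val.length = l.length / 5 ∧ (medians l).steps ≤ 7 * l.length + 1 ∧
      ∀ p, 3 * (medians l).val.countP (· ≤ p) ≤ l.countP (· ≤ p) ∧
        3 * (medians l).val.countP (p ≤ ·) ≤ l.countP (p ≤ ·) := by
  induction l using five_induction with
  | short l h => simp [medians_of_length_lt h]; omega
  | step a b c d e t ih =>
    obtain ⟨m, hm, h1, h2⟩ := val_medians_cons a b c d e t
    have h3 := steps_medians_cons_le a b c d e t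
    obtain ⟨ih1, ih2, ih3⟩ := ih
    refine ⟨by simp [hm]; omega, by simp; omega, fun p => ?_⟩
    have e1 : a :: b :: c :: d :: e :: t = [a, b, c, d, e] ++ t := rfl
    rw [hm, e1, List.countP_append, List.countP_append, List.countP_cons,
      List.countP_cons (a := m)]
    obtain ⟨i1, i2⟩ := ih3 p
    constructor
    · by_cases h : m ≤ p
      · have := h1 p h; simp only [h, decide_true, if_true]; omega
      · simp only [h, decide_false, Bool.false_eq_true, if_false]; omega
    · by_cases h : p ≤ m
      · have := h2 p h; simp only [h, decide_true, if_true]; omega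
      · simp only [h, decide_false, Bool.false_eq_true, if_false]; omega

theorem countP_lt_add_countP_ge (p : R) (l : List R) :
    l.countP (· < p) + l.countP (p ≤ ·) = l.length := by
  rw [List.length_eq_countP_add_countP (p := fun x => decide (x < p))]
  congr 1
  apply List.countP_congr
  simp

theorem countP_le_add_countP_gt (p : R) (l : List R) :
    l.countP (· ≤ p) + l.countP (p < ·) = l.length := by
  rw [List.length_eq_countP_add_countP (p := fun x => decide (x ≤ p))]
  congr 1
  apply List.countP_congr
  simp

/-- At least half of the `g = n / 5` medians lie on either side of `p` (inclusively), and each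
brings three entries of its group along, so about `3 n / 10` entries are excluded from each strict
part. The `12` pays for the up to four entries outside complete groups. -/
theorem hasRank_medians {l : List R} {p : R}
    (h : HasRank ((medians l).val.length / 2) (medians l).val p) :
    10 * (l.filter (· < p)).length ≤ 7 * l.length + 12 ∧
      10 * (l.filter (p < ·)).length ≤ 7 * l.length := by
  obtain ⟨hl, -, hc⟩ := medians_spec l
  obtain ⟨c1, c2⟩ := hc p
  obtain ⟨h1, h2⟩ := h
  have e1 := countP_lt_add_countP_ge p l
  have e2 := countP_le_add_countP_gt p l
  have e3 := countP_lt_add_countP_ge p (medians l).val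
  rw [← List.countP_eq_length_filter, ← List.countP_eq_length_filter]
  omega

/-- Since `r < p`, the discarded entries, all at least `p`, contribute to neither of the two counts
that define the rank. -/
theorem HasRank.of_filter_lt {i : ℕ} {l : List R} {p r : R}
    (h : HasRank i (l.filter (· < p)) r) : HasRank i l r := by
  have hr : r < p := by simpa using (List.mem_filter.1 h.mem).2
  obtain ⟨h1, h2⟩ := h
  rw [List.countP_filter] at h1 h2
  constructor
  · refine le_of_eq_of_le (List.countP_congr fun a _ => ?_) h1
    simpa using fun h => h.trans hr
  · refine lt_of_lt_of_eq h2 (List.countP_congr fun a _ => ?_)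
    simpa using fun h => h.trans_lt hr

theorem HasRank.of_filter_gt {i : ℕ} {l : List R} {p r : R}
    (hi : (l.filter (· < p)).length + (l.filter (· = p)).length ≤ i)
    (h : HasRank (i - (l.filter (· < p)).length - (l.filter (· = p)).length)
      (l.filter (p < ·)) r) : HasRank i l r := by
  have hr : p < r := by simpa using (List.mem_filter.1 h.mem).2
  obtain ⟨h1, h2⟩ := h
  -- As `p < r`, the discarded entries satisfy both `· < r` and `· ≤ r`, so both counts shift by the
  -- same amount.
  have key : ∀ Q : R → Bool, (∀ a ≤ p, Q a) → l.countP Q =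
      (l.filter (· < p)).length + (l.filter (· = p)).length + (l.filter (p < ·)).countP Q := by
    intro Q hQ
    clear h1 h2 hi
    induction l with
    | nil => rfl
    | cons a t ih =>
      rcases lt_trichotomy a p with h | h | h
      · simp [h, h.ne, not_lt.2 h.le, hQ a h.le, ih]; omega
      · simp [h, hQ p le_rfl, ih]; omega
      · simp [h, h.ne', not_lt.2 h.le, List.countP_cons, ih]; omega
  constructor
  · rw [key _ (fun a h => by simpa using h.trans_lt hr)]; omega
  · rw [key _ (fun a h => by simpa using h.trans hr.le)]; omega

theorem hasRank_of_filter {i : ℕ} {l : List R} {p : R}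
    (h1 : (l.filter (· < p)).length ≤ i)
    (h2 : i < (l.filter (· < p)).length + (l.filter (· = p)).length) : HasRank i l p := by
  have e1 := length_filter_trichotomy p l
  have e2 := countP_le_add_countP_gt p l
  simp only [List.countP_eq_length_filter] at e2
  simp only [HasRank, List.countP_eq_length_filter]
  omega

/-- The recursive calls see at most `n / 5` and `(7 n + 12) / 10` entries, hence cost at most `900 n
+ 1200`; for `n > 100` the remaining `100 n` covers this excess and the linear work of the round.
Recursion is always on strictly shorter lists, so fuel `n` suffices. -/
theorem select_spec (fuel i : ℕ) (l : List R) (hf : l.length ≤ fuel) (hi : i < l.length) :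
    (∃ p, (select fuel i l).val = some p ∧ HasRank i l p) ∧
      (select fuel i l).steps ≤ 1000 * l.length := by
  induction fuel generalizing i l with
  | zero => omega
  | succ fuel ih =>
    by_cases hn : l.length ≤ 100
    · obtain ⟨p, hp, hr⟩ := exists_hasRank_insertionSort hi
      constructor
      · refine ⟨p, ?_, hr⟩
        simpa [select, hn, val_insertionSort] using hp
      · have h1 := steps_insertionSort_le l
        have h2 := steps_nth_le i (l.insertionSort (· ≤ ·))
        rw [List.length_insertionSort] at h2
        simp only [select, Cost.steps_bind, steps_tick, val_length, steps_length, hn, if_true,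
          val_insertionSort]
        nlinarith
    · obtain ⟨hm, hms, -⟩ := medians_spec l
      obtain ⟨⟨p, hp, hr⟩, hs⟩ := ih ((medians l).val.length / 2) (medians l).val
        (by omega) (by omega)
      obtain ⟨b1, b2⟩ := hasRank_medians hr
      have e := length_filter_trichotomy p l
      simp only [select, Cost.val_bind, val_length, hn, if_false, hp, val_partition,
        Cost.steps_bind, steps_tick, steps_length, steps_partition]
      by_cases c1 : i < (l.filter (· < p)).length
      · obtain ⟨⟨r, hr1, hr2⟩, ht⟩ := ih i (l.filter (· < p)) (by omega) c1
        simp only [c1, if_true]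
        exact ⟨⟨r, hr1, hr2.of_filter_lt⟩, by omega⟩
      · by_cases c2 : i < (l.filter (· < p)).length + (l.filter (· = p)).length
        · simp only [c1, c2, if_true, if_false, Cost.val_pure, Cost.steps_pure]
          exact ⟨⟨p, rfl, hasRank_of_filter (by omega) c2⟩, by omega⟩
        · obtain ⟨⟨r, hr1, hr2⟩, ht⟩ := ih
            (i - (l.filter (· < p)).length - (l.filter (· = p)).length)
            (l.filter (p < ·)) (by omega) (by omega)
          simp only [c1, c2, if_false]
          exact ⟨⟨r, hr1, hr2.of_filter_gt (by omega)⟩, by omega⟩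

/-- The pivot has rank `k - 1`: fewer than `k` entries lie strictly below it and at least `k` are at
most it. Copies of the pivot fill the gap. -/
theorem smallest_spec (k : ℕ) (l : List R) (hk : k ≤ l.length) :
    ∃ small large, (smallest k l).val = (small, large) ∧ small.length = k ∧
      (small ++ large).Perm l ∧ (∀ a ∈ small, ∀ b ∈ large, a ≤ b) ∧
      (smallest k l).steps ≤ 1010 * l.length + 10 := by
  by_cases h0 : k = 0
  · subst h0
    exact ⟨[], l, by simp [smallest], rfl, by simp, by simp, by simp [smallest]⟩
  · obtain ⟨⟨p, hp, hr⟩, hs⟩ := select_spec l.length (k - 1) l le_rfl (by omega)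
    have e := length_filter_trichotomy p l
    have e2 := countP_le_add_countP_gt p l
    obtain ⟨h1, h2⟩ := hr
    simp only [List.countP_eq_length_filter] at h1 h2 e2
    have s1 := steps_splitAt_le (k - (l.filter (· < p)).length) (l.filter (· = p))
    refine ⟨l.filter (· < p) ++ (l.filter (· = p)).take (k - (l.filter (· < p)).length),
      (l.filter (· = p)).drop (k - (l.filter (· < p)).length) ++ l.filter (p < ·),
      ?_, ?_, ?_, ?_, ?_⟩
    · simp [smallest, h0, hp, val_partition]
    · simp only [List.length_append, List.length_take]; omega
    · rw [List.append_assoc, ← List.append_assoc (List.take _ _), List.take_append_drop]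
      clear * -
      induction l with
      | nil => simp
      | cons a t ih =>
        rcases lt_trichotomy a p with h | h | h
        · simpa [h, h.ne, not_lt.2 h.le] using ih
        · simp only [h, lt_self_iff_false, decide_false, Bool.false_eq_true, not_false_eq_true,
            List.filter_cons_of_neg, decide_true, List.filter_cons_of_pos, List.cons_append]
          exact List.perm_middle.trans (ih.cons p)
        · simp only [h, h.ne', not_lt.2 h.le, decide_false, Bool.false_eq_true,
            not_false_eq_true, List.filter_cons_of_neg, decide_true, List.filter_cons_of_pos,
            ← List.append_assoc]
          refine List.perm_middle.trans ?_
          rw [List.append_assoc]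
          exact ih.cons a
    · intro a ha b hb
      have ha' : a ≤ p := by
        rcases List.mem_append.1 ha with h | h
        · exact le_of_lt (by simpa using (List.mem_filter.1 h).2)
        · exact le_of_eq (by simpa using (List.mem_filter.1 (List.mem_of_mem_take h)).2)
      have hb' : p ≤ b := by
        rcases List.mem_append.1 hb with h | h
        · exact ge_of_eq (by simpa using (List.mem_filter.1 (List.mem_of_mem_drop h)).2)
        · exact le_of_lt (by simpa using (List.mem_filter.1 h).2)
      exact ha'.trans hb'
    · simp only [smallest, h0, if_false, Cost.steps_bind, steps_tick, val_length, steps_length,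
        hp, val_partition, steps_partition, val_splitAt, steps_append, Cost.steps_pure, val_append,
        List.length_drop]
      omega

end SelectionLemmas

/-! ### Building a layer-ordered heap -/

section LayerLemmas

variable {R : Type}

/-- The position at which the layer with index `u` starts. -/
def layerStart (σ : ℕ → ℕ) (u : ℕ) : ℕ := ∑ i ∈ Finset.range u, σ i

theorem layerStart_succ (σ : ℕ → ℕ) (u : ℕ) :
    layerStart σ (u + 1) = layerStart σ u + σ u := Finset.sum_range_succ _ _

/-- The starts of the first `m` layers, last layer first. -/
def startsList (σ : ℕ → ℕ) : ℕ → List ℕ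
  | 0 => []
  | m + 1 => layerStart σ m :: startsList σ m

/-- Layers are non-empty, so the start advances in every round and the fuel outlasts the vector. The
condition on `u - 1` records that the latest start listed lies inside the vector, so the cut-off
layer is not empty. -/
theorem layerStarts_spec {σ : ℕ → ℕ} (hσ : ∀ u, 0 < σ u) (n fuel u : ℕ)
    (hf : n < fuel + layerStart σ u) (hu : u = 0 ∨ layerStart σ (u - 1) < n) :
    (∃ m, (layerStarts σ n fuel u (layerStart σ u) (startsList σ u)).val = startsList σ m ∧
      n ≤ layerStart σ m ∧ (m = 0 ∨ layerStart σ (m - 1) < n)) ∧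
      (layerStarts σ n fuel u (layerStart σ u) (startsList σ u)).steps ≤ fuel + 1 := by
  induction fuel generalizing u with
  | zero => exact ⟨⟨u, rfl, by omega, hu⟩, le_rfl⟩
  | succ fuel ih =>
    by_cases h : layerStart σ u < n
    · have e := layerStart_succ σ u
      have := hσ u
      obtain ⟨h1, h2⟩ := ih (u + 1) (by omega) (Or.inr (by simpa using h))
      rw [e] at h1 h2
      simp only [startsList] at h1 h2
      simp only [layerStarts, Cost.val_bind, h, if_true, Cost.steps_bind, steps_tick]
      exact ⟨h1, by omega⟩
    · simp only [layerStarts, Cost.val_bind, h, if_false, Cost.steps_bind, steps_tick,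
        Cost.val_pure, Cost.steps_pure]
      exact ⟨⟨u, rfl, by omega, hu⟩, by omega⟩

variable [LinearOrder R]

/-- Every entry of a list is at most every entry of the later ones. -/
def Layered (ls : List (List R)) : Prop := ls.Pairwise fun l m => ∀ a ∈ l, ∀ b ∈ m, a ≤ b

/-- The case in which no layer is cut off: each selection runs on exactly the first `i + 1` layers,
which accounts for the summands of the bound. -/
theorem peel_spec_full (σ : ℕ → ℕ) (m : ℕ) (l : List R) (hl : l.length = layerStart σ m)
    (acc : List (List R)) :
    (∃ ls, (peel (startsList σ m) l acc).val = ls ++ acc ∧ ls.flatten.Perm l ∧ Layered ls ∧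
      ls.map List.length = (List.range m).map σ) ∧
      (peel (startsList σ m) l acc).steps ≤
        1010 * (∑ i ∈ Finset.range m, layerStart σ (i + 1)) + 11 * m + 1 := by
  induction m generalizing l acc with
  | zero =>
    obtain rfl : l = [] := List.eq_nil_of_length_eq_zero hl
    exact ⟨⟨[], rfl, by simp, List.Pairwise.nil, rfl⟩, by simp [startsList, peel]⟩
  | succ m ih =>
    have e := layerStart_succ σ m
    obtain ⟨small, large, h1, h2, h3, h4, h5⟩ := smallest_spec (layerStart σ m) l (by omega)
    obtain ⟨⟨ls, i1, i2, i3, i4⟩, i5⟩ := ih small h2 (large :: acc)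
    have hlen := h3.length_eq
    rw [List.length_append] at hlen
    simp only [startsList, peel, Cost.val_bind, h1, Cost.steps_bind, steps_tick]
    refine ⟨⟨ls ++ [large], by simpa using i1, ?_, ?_, ?_⟩, ?_⟩
    · simp only [List.flatten_append, List.flatten_cons, List.flatten_nil, List.append_nil]
      exact (i2.append_right _).trans h3
    · refine List.pairwise_append.2 ⟨i3, List.pairwise_singleton _ _, fun s hs b hb x hx y hy => ?_⟩
      rw [List.mem_singleton] at hb
      subst hb
      exact h4 x (i2.mem_iff.1 (List.mem_flatten.2 ⟨s, hs, hx⟩)) y hy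
    · rw [List.map_append, i4, List.range_succ, List.map_append]
      simp only [List.map_cons, List.map_nil]
      congr 2
      omega
    · rw [Finset.sum_range_succ, mul_add]
      omega

/-- Only the first selection meets the cut-off layer; it is charged by the actual length of the
vector, since `layerStart σ m` may exceed it. What remains consists of full layers. -/
theorem peel_spec {σ : ℕ → ℕ} (hσ : ∀ u, 0 < σ u) (m : ℕ) (l : List R) (hl : l.length ≤ layerStart σ m)
    (hm : m = 0 ∨ layerStart σ (m - 1) < l.length) :
    (∃ ls, (peel (startsList σ m) l []).val = ls ∧ ls.flatten.Perm l ∧ Layered ls ∧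
      ls.length = m ∧ (∀ s ∈ ls, s ≠ []) ∧
      (∀ u (h : u < ls.length), ls[u].length ≤ σ u ∧ (u + 1 < m → ls[u].length = σ u))) ∧
      (peel (startsList σ m) l []).steps ≤ 1010 * l.length +
        1010 * (∑ i ∈ Finset.range (m - 1), layerStart σ (i + 1)) + 11 * m + 1 := by
  cases m with
  | zero =>
    obtain rfl : l = [] := List.eq_nil_of_length_eq_zero (Nat.le_zero.1 hl)
    exact ⟨⟨[], rfl, by simp, List.Pairwise.nil, rfl, by simp, by simp⟩, by simp [startsList, peel]⟩
  | succ m =>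
    have e := layerStart_succ σ m
    simp only [Nat.add_sub_cancel, Nat.succ_ne_zero, false_or] at hm
    obtain ⟨small, large, h1, h2, h3, h4, h5⟩ := smallest_spec (layerStart σ m) l (by omega)
    obtain ⟨⟨ls, i1, i2, i3, i4⟩, i5⟩ := peel_spec_full σ m small h2 [large]
    have hlen := h3.length_eq
    rw [List.length_append] at hlen
    have hls : ls.length = m := by simpa using congrArg List.length i4
    have hget : ∀ u (h : u < ls.length), ls[u].length = σ u := by
      intro u h
      have : (ls.map List.length)[u]'(by simpa using h) =
          ((List.range m).map σ)[u]'(by simpa using hls ▸ h) := by simp only [i4]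
      simpa using this
    simp only [startsList, peel, Cost.val_bind, h1, Cost.steps_bind, steps_tick,
      Nat.add_sub_cancel]
    refine ⟨⟨ls ++ [large], i1, ?_, ?_, by simp [hls], ?_, ?_⟩, by omega⟩
    · simp only [List.flatten_append, List.flatten_cons, List.flatten_nil, List.append_nil]
      exact (i2.append_right _).trans h3
    · refine List.pairwise_append.2 ⟨i3, List.pairwise_singleton _ _, fun s hs b hb x hx y hy => ?_⟩
      rw [List.mem_singleton] at hb
      subst hb
      exact h4 x (i2.mem_iff.1 (List.mem_flatten.2 ⟨s, hs, hx⟩)) y hy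
    · intro s hs
      rw [← List.length_pos_iff]
      rcases List.mem_append.1 hs with h | h
      · obtain ⟨u, hu, rfl⟩ := List.getElem_of_mem h
        rw [hget]
        exact hσ u
      · rw [List.mem_singleton.1 h]
        omega
    · intro u hu
      rcases lt_or_eq_of_le (Nat.lt_succ_iff.1 (by simpa [hls] using hu)) with h | h
      · rw [List.getElem_append_left (by omega), hget]
        simp
      · subst h
        rw [List.getElem_append_right (by omega)]
        simp [hls]
        omega

theorem scan_spec (l : List R) (m : ℕ) (lo hi : R) :
    ∃ lo' hi', (scan l m lo hi).val = (m + l.length, lo', hi') ∧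
      lo' ∈ lo :: l ∧ hi' ∈ hi :: l ∧ (∀ x ∈ lo :: l, lo' ≤ x) ∧ (∀ x ∈ hi :: l, x ≤ hi') ∧
      (scan l m lo hi).steps = l.length + 1 := by
  induction l generalizing m lo hi with
  | nil => exact ⟨lo, hi, rfl, by simp, by simp, by simp, by simp, rfl⟩
  | cons a t ih =>
    obtain ⟨lo', hi', h1, h2, h3, h4, h5, h6⟩ := ih (m + 1) (min lo a) (max hi a)
    refine ⟨lo', hi', ?_, ?_, ?_, ?_, ?_, ?_⟩
    · simp only [scan, Cost.val_bind, h1, List.length_cons]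
      congr 1; omega
    · rcases min_choice lo a with h | h <;> rw [h] at h2 <;> simp at h2 ⊢ <;> tauto
    · rcases max_choice hi a with h | h <;> rw [h] at h3 <;> simp at h3 ⊢ <;> tauto
    · simp at h4 ⊢; tauto
    · simp at h5 ⊢; tauto
    · simp [scan, h6]; omega

/-- The fields of the layer `a` correctly describe the list `l`. -/
structure Layer.Describes (a : Layer R) (l : List R) : Prop where
  entries_eq : a.entries = l
  size_eq : a.size = l.length
  lo_mem : a.lo ∈ l
  hi_mem : a.hi ∈ l
  lo_le : ∀ x ∈ l, a.lo ≤ x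
  le_hi : ∀ x ∈ l, x ≤ a.hi

/-- `store` skips empty lists, which would shift all later indices; non-emptiness keeps array
positions equal to layer indices. -/
theorem store_spec (ls : List (List R)) (hls : ∀ l ∈ ls, l ≠ []) (acc : Array (Layer R)) :
    (∃ L, (store ls acc).val.toList = acc.toList ++ L ∧ List.Forall₂ Layer.Describes L ls) ∧
      (store ls acc).steps ≤ ls.flatten.length + ls.length + 1 := by
  induction ls generalizing acc with
  | nil => exact ⟨⟨[], by simp [store], .nil⟩, by simp [store]⟩
  | cons l ls ih =>
    cases l with
    | nil => exact absurd rfl (hls [] (by simp))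
    | cons a t =>
      obtain ⟨lo, hi, h1, h2, h3, h4, h5, h6⟩ := scan_spec t 1 a a
      obtain ⟨⟨L, i1, i2⟩, i3⟩ := ih (fun l hl => hls l (by simp [hl]))
        (acc.push ⟨a :: t, 1 + t.length, lo, hi⟩)
      simp only [store, Cost.val_bind, h1, Cost.steps_bind, steps_tick, h6]
      refine ⟨⟨⟨a :: t, 1 + t.length, lo, hi⟩ :: L, by simp [i1], .cons ?_ i2⟩, ?_⟩
      · exact ⟨rfl, by simp; omega, h2, h3, h4, h5⟩
      · simp at i3 ⊢; omega

/-- `A` is a layer-ordered heap of `X`, with layers of sizes `σ 0, σ 1, …`. -/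
structure IsLOH (σ : ℕ → ℕ) (X : List R) (A : Array (Layer R)) : Prop where
  perm : (A.toList.flatMap Layer.entries).Perm X
  describes : ∀ u (h : u < A.size), A[u].Describes A[u].entries
  sorted : ∀ u v (_ : u < v) (h : v < A.size), A[u].hi ≤ A[v].lo
  size_le : ∀ u (h : u < A.size), A[u].size ≤ σ u
  size_eq : ∀ u (h : u + 1 < A.size), A[u].size = σ u
  start_lt : A.size = 0 ∨ layerStart σ (A.size - 1) < X.length

theorem lohify_spec {σ : ℕ → ℕ} (hσ : ∀ u, 0 < σ u) (X : List R) :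
    IsLOH σ X (lohify σ X).val ∧ (lohify σ X).steps ≤ 1020 * X.length +
        1010 * (∑ i ∈ Finset.range ((lohify σ X).val.size - 1), layerStart σ (i + 1)) +
        20 * (lohify σ X).val.size + 10 := by
  obtain ⟨⟨m, h1, h2, h3⟩, h4⟩ := layerStarts_spec hσ X.length (X.length + 1) 0
    (by omega) (Or.inl rfl)
  obtain ⟨⟨ls, i1, i2, i3, i4, i5, i6⟩, i7⟩ := peel_spec hσ m X h2 h3
  obtain ⟨⟨L, j1, j2⟩, j3⟩ := store_spec ls i5 #[]
  have hv : (lohify σ X).val = (store ls #[]).val := by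
    simp only [lohify, Cost.val_bind, val_length]
    rw [← i1, ← h1]
    rfl
  have hlen := i2.length_eq
  have hs : (lohify σ X).steps ≤ (X.length + 1) + (X.length + 2) + (1010 * X.length +
        1010 * (∑ i ∈ Finset.range (m - 1), layerStart σ (i + 1)) + 11 * m + 1) +
        (X.length + m + 1) + 1 := by
    simp only [lohify, Cost.steps_bind, val_length, steps_tick, steps_length]
    rw [show (layerStarts σ X.length (X.length + 1) 0 0 []).val = startsList σ m from h1, i1]
    have : (layerStarts σ X.length (X.length + 1) 0 0 []).steps ≤ X.length + 1 + 1 := h4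
    omega
  rw [List.nil_append] at j1
  have hAL := j1
  generalize (store ls #[]).val = A at *
  subst hAL
  have hsz : A.size = m := by
    rw [← i4, ← j2.length_eq]; simp
  rw [hv, hsz]
  have hd : ∀ u (h : u < A.size), A[u].Describes (ls[u]'(by omega)) := by
    intro u h
    have := j2.get (i := u) (by simpa using h) (by omega)
    simpa using this
  refine ⟨⟨?_, fun u h => ?_, fun u v huv h => ?_, fun u h => ?_, fun u h => ?_, ?_⟩, by omega⟩
  · have : A.toList.map Layer.entries = ls := by
      have : ∀ (L : List (Layer R)) ls, List.Forall₂ Layer.Describes L ls →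
          L.map Layer.entries = ls := by
        intro L ls h
        induction h with
        | nil => rfl
        | cons h _ ih => simp [h.entries_eq, ih]
      exact this _ _ j2
    rwa [List.flatMap_def, this]
  · have := hd u h
    rwa [this.entries_eq]
  · exact List.pairwise_iff_getElem.1 i3 u v (by omega) (by omega) huv _ (hd u (by omega)).hi_mem
      _ (hd v h).lo_mem
  · rw [(hd u h).size_eq]; exact (i6 u (by omega)).1
  · rw [(hd u (by omega)).size_eq]; exact (i6 u (by omega)).2 (by omega)
  · rwa [hsz]

end LayerLemmas

/-! ### Geometric growth of the layer sizes -/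

section GrowthLemmas

variable {α : ℝ} {σ : ℕ → ℕ}

/-- A convergent sequence of ratios is bounded. The requirement `1 ≤ M` allows the bound to be used
also when the predecessor of layer `0` is taken to be layer `0`. -/
theorem IsLayerSizes.exists_succ_le (hσ : IsLayerSizes α σ) :
    ∃ M : ℕ, 1 ≤ M ∧ ∀ u, σ (u + 1) ≤ M * σ u := by
  obtain ⟨B, hB⟩ := hσ.ratio.bddAbove_range
  refine ⟨⌈B⌉₊ + 1, by omega, fun u => ?_⟩
  have h1 : (σ (u + 1) : ℝ) / σ u ≤ B := hB ⟨u, rfl⟩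
  have h2 : (0 : ℝ) < σ u := by exact_mod_cast hσ.pos u
  rw [div_le_iff₀ h2] at h1
  have h3 : (σ (u + 1) : ℝ) ≤ ((⌈B⌉₊ + 1 : ℕ) : ℝ) * σ u := by
    refine h1.trans (mul_le_mul_of_nonneg_right ?_ h2.le)
    push_cast
    linarith [Nat.le_ceil B]
  exact_mod_cast h3

/-- Eventually sizes grow by a factor `β` strictly between `1` and `α`, so the sum of the layers is
dominated by its last term as in a geometric series. -/
theorem IsLayerSizes.exists_layerStart_le (hα : 1 < α) (hσ : IsLayerSizes α σ) :
    ∃ K : ℕ, 1 ≤ K ∧ ∀ u, layerStart σ (u + 1) ≤ K * σ u := by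
  set β := (1 + α) / 2 with hβ
  have hβ1 : 1 < β := by rw [hβ]; linarith
  have hβα : β < α := by rw [hβ]; linarith
  obtain ⟨N, hN⟩ := Filter.eventually_atTop.1 (hσ.ratio.eventually_const_le hβα)
  -- The first term settles the indices up to `N`, where `σ u ≥ 1` is enough. The second makes the
  -- induction close: `K / β + 1 ≤ K` exactly when `β / (β - 1) ≤ K`.
  set K := max (layerStart σ (N + 1)) ⌈β / (β - 1)⌉₊ + 1 with hK
  have hK1 : layerStart σ (N + 1) ≤ K := by omega
  have hK2 : β / (β - 1) ≤ K := by
    refine (Nat.le_ceil _).trans ?_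
    exact_mod_cast (by omega)
  have small : ∀ u ≤ N, layerStart σ (u + 1) ≤ K * σ u := by
    intro u hu
    have h1 : layerStart σ (u + 1) ≤ layerStart σ (N + 1) :=
      Finset.sum_le_sum_of_subset (Finset.range_mono (by omega))
    exact h1.trans (hK1.trans (Nat.le_mul_of_pos_right K (hσ.pos u)))
  refine ⟨K, by omega, fun u => ?_⟩
  rcases le_total u N with hu | hu
  · exact small u hu
  induction u, hu using Nat.le_induction with
  | base => exact small N le_rfl
  | succ u hu ih =>
    have h2 : (0 : ℝ) < σ u := by exact_mod_cast hσ.pos u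
    have h1 : β * σ u ≤ σ (u + 1) := (le_div_iff₀ h2).1 (hN u hu)
    have ih' : (layerStart σ (u + 1) : ℝ) ≤ K * σ u := by exact_mod_cast ih
    rw [div_le_iff₀ (by linarith)] at hK2
    have : (layerStart σ (u + 1 + 1) : ℝ) ≤ K * σ (u + 1) := by
      rw [layerStart_succ]
      push_cast
      have h3 : (K : ℝ) * (β * σ u) ≤ K * σ (u + 1) :=
        mul_le_mul_of_nonneg_left h1 (Nat.cast_nonneg K)
      have h4 : β * σ (u + 1) ≤ K * (β - 1) * σ (u + 1) :=
        mul_le_mul_of_nonneg_right hK2 (Nat.cast_nonneg _)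
      have h5 : β * layerStart σ (u + 1) ≤ β * (K * σ u) :=
        mul_le_mul_of_nonneg_left ih' (by linarith)
      nlinarith
    exact_mod_cast this

theorem sum_layerStart_le {K : ℕ} (hK : ∀ u, layerStart σ (u + 1) ≤ K * σ u) (m : ℕ) :
    ∑ i ∈ Finset.range m, layerStart σ (i + 1) ≤ K * layerStart σ m := by
  rw [layerStart, Finset.mul_sum]
  exact Finset.sum_le_sum fun i _ => hK i

theorem le_layerStart (h : ∀ u, 0 < σ u) (m : ℕ) : m ≤ layerStart σ m := by
  induction m with
  | zero => simp
  | succ m ih => have := h m; rw [layerStart_succ]; omega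

/-- Read backwards, the bound by `K` says that each new layer is at least `1 / K` of everything
before it, so the starts grow by a factor of at least `1 + 1 / K`. -/
theorem pow_le_layerStart {K : ℕ} (h1 : 1 ≤ K) (h0 : ∀ u, 0 < σ u)
    (hK : ∀ u, layerStart σ (u + 1) ≤ K * σ u) (m : ℕ) :
    (1 + 1 / (K : ℝ)) ^ m ≤ layerStart σ (m + 1) := by
  have hK0 : (0 : ℝ) < K := by exact_mod_cast h1
  induction m with
  | zero =>
    have : 1 ≤ layerStart σ 1 := le_layerStart h0 1
    simpa using this
  | succ m ih =>
    have e := layerStart_succ σ (m + 1)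
    have h2 : (layerStart σ (m + 1 + 1) : ℝ) ≤ K * σ (m + 1) := by exact_mod_cast hK (m + 1)
    have h3 : (layerStart σ (m + 1 + 1) : ℝ) = layerStart σ (m + 1) + σ (m + 1) := by
      exact_mod_cast e
    have h4 : (0 : ℝ) ≤ σ (m + 1) := Nat.cast_nonneg _
    have h5 : (layerStart σ (m + 1) : ℝ) / K ≤ σ (m + 1) := by
      rw [div_le_iff₀ hK0]
      linarith
    calc (1 + 1 / (K : ℝ)) ^ (m + 1) = (1 + 1 / (K : ℝ)) ^ m * (1 + 1 / K) := pow_succ _ _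
      _ ≤ layerStart σ (m + 1) * (1 + 1 / K) := mul_le_mul_of_nonneg_right ih (by positivity)
      _ = layerStart σ (m + 1) + layerStart σ (m + 1) / K := by ring
      _ ≤ layerStart σ (m + 1 + 1) := by rw [h3]; linarith

/-- A vector of length `n` has `O(1 + log n)` layers. -/
theorem IsLayerSizes.exists_size_le_log (hα : 1 < α) (hσ : IsLayerSizes α σ) :
    ∃ L : ℝ, 1 ≤ L ∧ ∀ m n : ℕ, 1 ≤ n → (m = 0 ∨ layerStart σ (m - 1) < n) →
      (m : ℝ) ≤ L * (1 + Real.log n) := by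
  obtain ⟨K, hK1, hK⟩ := hσ.exists_layerStart_le hα
  have hK0 : (0 : ℝ) < K := by exact_mod_cast hK1
  have hl : 0 < Real.log (1 + 1 / (K : ℝ)) := Real.log_pos (by simp [hK0])
  -- The `2` covers `m < 2` and the shift `m = j + 2`; the other term bounds `j` by comparing `(1 +
  -- 1 / K) ^ j` with `n`.
  refine ⟨2 + 1 / Real.log (1 + 1 / (K : ℝ)), by linarith [one_div_pos.2 hl], fun m n hn hm => ?_⟩
  have hn0 : 0 ≤ Real.log n := Real.log_natCast_nonneg n
  have hbase : (2 : ℝ) ≤ (2 + 1 / Real.log (1 + 1 / (K : ℝ))) * (1 + Real.log n) := by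
    nlinarith [one_div_pos.2 hl]
  rcases lt_or_ge m 2 with h | h
  · have : (m : ℝ) ≤ 2 := by exact_mod_cast h.le
    linarith
  · obtain ⟨j, rfl⟩ := Nat.exists_eq_add_of_le' h
    have h1 : layerStart σ (j + 1) < n := by simpa using hm
    have h2 := pow_le_layerStart hK1 hσ.pos hK j
    have h3 : (1 + 1 / (K : ℝ)) ^ j ≤ n := h2.trans (by exact_mod_cast h1.le)
    have h4 := Real.log_le_log (by positivity) h3
    rw [Real.log_pow, ← le_div_iff₀ hl] at h4
    push_cast
    have h5 : 0 < 1 / Real.log (1 + 1 / (K : ℝ)) := one_div_pos.2 hl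
    rw [div_eq_mul_one_div] at h4
    nlinarith

/-- All layers but the last fit into the vector, so the lengths of the selections after the first
add up to at most `K` times the length of the vector. -/
theorem phase0_steps_le {R : Type} [LinearOrder R] [Add R] (hα : 1 < α)
    (hσ : IsLayerSizes α σ) : ∃ C : ℕ, ∀ X Y : List R, 1 ≤ X.length → 1 ≤ Y.length →
      (phase0 σ X Y).steps ≤ C * (X.length + Y.length) := by
  obtain ⟨K, hK1, hK⟩ := hσ.exists_layerStart_le hα
  have key : ∀ X : List R, 1 ≤ X.length →
      (lohify σ X).steps ≤ (1070 + 1010 * K) * X.length := by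
    intro X hX
    obtain ⟨h1, h2⟩ := lohify_spec hσ.pos X
    have h3 := sum_layerStart_le hK ((lohify σ X).val.size - 1)
    have h4 := le_layerStart hσ.pos ((lohify σ X).val.size - 1)
    have h5 : layerStart σ ((lohify σ X).val.size - 1) ≤ X.length := by
      rcases h1.start_lt with h | h
      · rw [h]; exact Nat.zero_le _
      · exact h.le
    have h6 := Nat.mul_le_mul_left K h5
    have h7 : (lohify σ X).val.size ≤ X.length + 1 := by omega
    rw [add_mul, mul_assoc]
    omega
  refine ⟨1071 + 1010 * K, fun X Y hX hY => ?_⟩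
  have h1 := key X hX
  have h2 := key Y hY
  simp only [phase0, Cost.steps_bind, steps_tick, Cost.steps_pure]
  nlinarith

end GrowthLemmas

/-! ### Binary heaps -/

section HeapLemmas

variable {β : Type}

/-- The labels of a tree. -/
def Tree.elems : Tree β → Multiset β
  | .leaf => 0
  | .node l x r => x ::ₘ (l.elems + r.elems)

/-- Here and in the other heap operations the cost is bounded by the number of labels instead of the
depth. With polylogarithmically many corners this is good enough, and no balance invariant has to be
carried. -/
theorem Tree.removeLeft_spec (t : Tree β) :
    (t.removeLeft.val = none → t = .leaf) ∧
      (∀ y t', t.removeLeft.val = some (y, t') → t.elems = y ::ₘ t'.elems) ∧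
      t.removeLeft.steps ≤ t.elems.card + 1 := by
  induction t with
  | leaf => simp [removeLeft, elems]
  | node l x r ihl ihr =>
    obtain ⟨h1, h2, h3⟩ := ihl
    simp only [removeLeft, Cost.val_bind, Cost.steps_bind, steps_tick]
    rcases h : l.removeLeft.val with _ | ⟨y, l1⟩
    · rw [h1 h] at h3 ⊢
      refine ⟨by simp, ?_, ?_⟩
      · rintro y t' e
        simp at e
        obtain ⟨rfl, rfl⟩ := e
        simp [elems]
      · simp [elems] at h3 ⊢; omega
    · refine ⟨by simp, ?_, ?_⟩
      · rintro y' t' e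
        simp at e
        obtain ⟨rfl, rfl⟩ := e
        simp only [elems, h2 y l1 h]
        rw [Multiset.cons_add, Multiset.cons_swap, add_comm]
      · simp [elems]; omega

variable [LinearOrder β]

/-- The label of every node is at most the labels below it. -/
def Tree.IsHeap : Tree β → Prop
  | .leaf => True
  | .node l x r => (∀ y ∈ l.elems, x ≤ y) ∧ (∀ y ∈ r.elems, x ≤ y) ∧ l.IsHeap ∧ r.IsHeap

theorem Tree.isHeap_removeLeft {t : Tree β} (ht : t.IsHeap) {y : β} {t' : Tree β}
    (h : t.removeLeft.val = some (y, t')) : t'.IsHeap := by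
  induction t generalizing y t' with
  | leaf => simp [removeLeft] at h
  | node l x r ihl ihr =>
    obtain ⟨h1, h2, h3, h4⟩ := ht
    simp only [removeLeft, Cost.val_bind] at h
    rcases hl : l.removeLeft.val with _ | ⟨z, l1⟩
    · simp [hl] at h
      exact h.2 ▸ h4
    · simp [hl] at h
      obtain ⟨rfl, rfl⟩ := h
      refine ⟨h2, fun w hw => h1 w ?_, h4, ihl h3 hl⟩
      rw [(removeLeft_spec l).2.1 _ _ hl]
      exact Multiset.mem_cons_of_mem hw

theorem Tree.push_spec (a : β) (t : Tree β) :
    (t.push a).val.elems = a ::ₘ t.elems ∧ (t.IsHeap → (t.push a).val.IsHeap) ∧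
      (t.push a).steps ≤ t.elems.card + 1 := by
  induction t generalizing a with
  | leaf => simp [push, elems, IsHeap]
  | node l x r ihl ihr =>
    by_cases h : a ≤ x
    · obtain ⟨h1, h2, h3⟩ := ihr x
      simp only [push, Cost.val_bind, Cost.steps_bind, h, if_true, Cost.val_pure, Cost.steps_pure,
        steps_tick, elems, h1, IsHeap]
      refine ⟨by simp [add_comm], fun ⟨i1, i2, i3, i4⟩ => ⟨?_, ?_, h2 i4, i3⟩, by simp; omega⟩
      · intro y hy
        rcases Multiset.mem_cons.1 hy with rfl | hy
        exacts [h, h.trans (i2 y hy)]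
      · exact fun y hy => h.trans (i1 y hy)
    · obtain ⟨h1, h2, h3⟩ := ihr a
      simp only [push, Cost.val_bind, Cost.steps_bind, h, if_false, Cost.val_pure, Cost.steps_pure,
        steps_tick, elems, h1, IsHeap]
      refine ⟨?_, fun ⟨i1, i2, i3, i4⟩ => ⟨?_, ?_, h2 i4, i3⟩, by simp; omega⟩
      · rw [Multiset.cons_add, Multiset.cons_swap, add_comm]
      · intro y hy
        rcases Multiset.mem_cons.1 hy with rfl | hy
        exacts [(not_le.1 h).le, i2 y hy]
      · exact i1

theorem Tree.root_eq_none {β : Type} {t : Tree β} (h : t.root = none) : t = .leaf := by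
  cases t with
  | leaf => rfl
  | node l x r => simp [root] at h

theorem Tree.root_eq_some {t : Tree β} {x : β} (ht : t.IsHeap) (h : t.root = some x) :
    x ∈ t.elems ∧ ∀ y ∈ t.elems, x ≤ y := by
  cases t with
  | leaf => simp [root] at h
  | node l z r =>
    simp only [root, Option.some.injEq] at h
    subst h
    obtain ⟨h1, h2, -, -⟩ := ht
    refine ⟨by simp [elems], fun y hy => ?_⟩
    simp only [elems, Multiset.mem_cons, Multiset.mem_add] at hy
    rcases hy with rfl | hy | hy
    exacts [le_rfl, h1 y hy, h2 y hy]

theorem Tree.steps_sink_le (a : β) (t : Tree β) : (t.sink a).steps ≤ t.elems.card + 1 := by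
  induction t with
  | leaf => simp [sink]
  | node l z r ihl ihr =>
    simp only [sink, Cost.steps_bind, steps_tick, elems, Multiset.card_cons, Multiset.card_add]
    split
    · simp
    · split_ifs <;> simp; omega
    · split_ifs <;> simp; omega
    · split_ifs <;> simp <;> omega

/-- Sinking `a` replaces the label of the root by `a`. -/
theorem Tree.sink_spec (a : β) (t : Tree β) :
    ∀ l x r, t = .node l x r → l.IsHeap → r.IsHeap →
      (t.sink a).val.elems = a ::ₘ (l.elems + r.elems) ∧ (t.sink a).val.IsHeap := by
  induction t with
  | leaf => simp
  | node l z r ihl ihr =>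
    rintro _ _ _ ⟨⟩ hl hr
    -- Lifting the root label `x` of a subtree and sinking `a` into it exchanges `x` for `a` there,
    -- so with `x ≤ a` the lifted label still bounds everything below it.
    have sub : ∀ (t : Tree β), (∀ l x r, t = .node l x r → l.IsHeap → r.IsHeap →
        (t.sink a).val.elems = a ::ₘ (l.elems + r.elems) ∧ (t.sink a).val.IsHeap) → t.IsHeap →
        ∀ x, t.root = some x → x ≤ a → x ::ₘ (t.sink a).val.elems = a ::ₘ t.elems ∧
          (t.sink a).val.IsHeap ∧ ∀ y ∈ (t.sink a).val.elems, x ≤ y := by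
      intro t ih ht x hx hxa
      have hmin := (root_eq_some ht hx).2
      cases t with
      | leaf => simp [root] at hx
      | node l z r =>
        simp only [root, Option.some.injEq] at hx
        subst hx
        obtain ⟨h1, h2⟩ := ih l z r rfl ht.2.2.1 ht.2.2.2
        refine ⟨by rw [h1, elems, Multiset.cons_swap], h2, fun y hy => ?_⟩
        rw [h1, Multiset.mem_cons] at hy
        rcases hy with rfl | hy
        exacts [hxa, hmin y (Multiset.mem_cons_of_mem hy)]
    have keep : (∀ y ∈ l.elems, a ≤ y) → (∀ y ∈ r.elems, a ≤ y) →
        (Tree.node l a r).elems = a ::ₘ (l.elems + r.elems) ∧ (Tree.node l a r).IsHeap :=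
      fun h1 h2 => ⟨rfl, h1, h2, hl, hr⟩
    have left : ∀ x, l.root = some x → x ≤ a → (∀ y ∈ r.elems, x ≤ y) →
        (Tree.node (l.sink a).val x r).elems = a ::ₘ (l.elems + r.elems) ∧
          (Tree.node (l.sink a).val x r).IsHeap := by
      intro x hx hxa hxr
      obtain ⟨h1, h2, h3⟩ := sub l ihl hl x hx hxa
      exact ⟨by rw [elems, ← Multiset.cons_add, h1, Multiset.cons_add], h3, hxr, h2, hr⟩
    have right : ∀ x, r.root = some x → x ≤ a → (∀ y ∈ l.elems, x ≤ y) →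
        (Tree.node l x (r.sink a).val).elems = a ::ₘ (l.elems + r.elems) ∧
          (Tree.node l x (r.sink a).val).IsHeap := by
      intro x hx hxa hxl
      obtain ⟨h1, h2, h3⟩ := sub r ihr hr x hx hxa
      exact ⟨by rw [elems, ← Multiset.add_cons, h1, Multiset.add_cons], hxl, h3, hl, h2⟩
    simp only [sink, Cost.val_bind]
    split
    · next e1 e2 =>
      refine keep ?_ ?_ <;> simp [root_eq_none e1, root_eq_none e2, elems]
    · next x e1 e2 =>
      have h1 := (root_eq_some hl e1).2
      have h2 : ∀ x, ∀ y ∈ r.elems, x ≤ y := by simp [root_eq_none e2, elems]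
      split_ifs with h
      · exact keep (fun y hy => h.trans (h1 y hy)) (h2 a)
      · exact left x e1 (not_le.1 h).le (h2 x)
    · next y e1 e2 =>
      have h1 := (root_eq_some hr e2).2
      have h2 : ∀ x, ∀ y ∈ l.elems, x ≤ y := by simp [root_eq_none e1, elems]
      split_ifs with h
      · exact keep (h2 a) (fun y hy => h.trans (h1 y hy))
      · exact right y e2 (not_le.1 h).le (h2 y)
    · next x y e1 e2 =>
      have h1 := (root_eq_some hl e1).2
      have h2 := (root_eq_some hr e2).2
      split_ifs with h h'
      · exact keep (fun z hz => h.1.trans (h1 z hz)) (fun z hz => h.2.trans (h2 z hz))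
      · refine left x e1 ?_ (fun z hz => h'.trans (h2 z hz))
        by_contra hx
        exact h ⟨(not_le.1 hx).le, (not_le.1 hx).le.trans h'⟩
      · have h'' := (not_le.1 h').le
        refine right y e2 ?_ (fun z hz => h''.trans (h1 z hz))
        by_contra hy
        exact h ⟨(not_le.1 hy).le.trans h'', (not_le.1 hy).le⟩

theorem Tree.pop_spec (t : Tree β) (ht : t.IsHeap) :
    (t.pop.val = none → t.elems = 0) ∧
      (∀ c t', t.pop.val = some (c, t') →
        t.elems = c ::ₘ t'.elems ∧ t'.IsHeap ∧ ∀ y ∈ t.elems, c ≤ y) ∧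
      t.pop.steps ≤ 2 * t.elems.card + 2 := by
  cases t with
  | leaf => simp [pop, elems]
  | node l x r =>
    obtain ⟨h1, h2, h3⟩ := removeLeft_spec l
    obtain ⟨i1, i2, i3, i4⟩ := ht
    have hmin : ∀ y ∈ (Tree.node l x r).elems, x ≤ y := by
      intro y hy
      simp only [elems, Multiset.mem_cons, Multiset.mem_add] at hy
      rcases hy with rfl | hy | hy
      exacts [le_rfl, i1 y hy, i2 y hy]
    simp only [pop, Cost.val_bind, Cost.steps_bind, steps_tick]
    rcases h : l.removeLeft.val with _ | ⟨y, l1⟩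
    · rw [h1 h] at h3 hmin ⊢
      refine ⟨by simp, ?_, by simp [elems] at h3 ⊢; omega⟩
      rintro c t' e
      simp at e
      obtain ⟨rfl, rfl⟩ := e
      exact ⟨by simp [elems], i4, hmin⟩
    · obtain ⟨j1, j2⟩ := sink_spec y (.node r x l1) r x l1 rfl i4 (isHeap_removeLeft i3 h)
      have j3 := steps_sink_le y (.node r x l1)
      have e := h2 y l1 h
      refine ⟨by simp, ?_, ?_⟩
      · rintro c t' e'
        simp at e'
        obtain ⟨rfl, rfl⟩ := e'
        refine ⟨?_, j2, hmin⟩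
        rw [j1, elems, e, Multiset.cons_add, add_comm]
      · rw [e] at h3
        simp [elems, e] at h3 j3 ⊢
        omega

end HeapLemmas

/-! ### The trie of keys -/

section KeySetLemmas

/-- Whether a number belongs to a set. -/
def KeySet.Mem (k : ℕ) (t : KeySet) : Prop := (t.mem k).val = true

theorem KeySet.steps_mem_le (k : ℕ) (t : KeySet) : (t.mem k).steps ≤ k + 1 := by
  induction t generalizing k with
  | empty => simp [mem]
  | node b l r ihl ihr =>
    simp only [mem, Cost.steps_bind, steps_tick]
    split_ifs with h1 h2
    · simp
    · have := ihl ((k - 1) / 2); omega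
    · have := ihr ((k - 1) / 2); omega

theorem KeySet.write_node (b : Bool) (k : ℕ) (c : Bool) (l r : KeySet) :
    (KeySet.node c l r).write b k = (do
      tick
      if k = 0 then return .node b l r
      else if k % 2 = 1 then
        let l1 ← KeySet.write b ((k - 1) / 2) l
        return .node c l1 r
      else
        let r1 ← KeySet.write b ((k - 1) / 2) r
        return .node c l r1) := by
  rw [write.eq_def]

theorem KeySet.write_empty (b : Bool) (k : ℕ) :
    KeySet.empty.write b k = (KeySet.node false .empty .empty).write b k := by
  rw [write_node, write.eq_def]

/-- A bound linear in the key, crude for a trie, suffices because keys are smaller than `2 * A.size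
* B.size` (`key_lt`). -/
theorem KeySet.steps_write_le (b : Bool) (k : ℕ) (t : KeySet) :
    (t.write b k).steps ≤ k + 1 := by
  induction k using Nat.strong_induction_on generalizing t with
  | _ k ih =>
    have key : ∀ c l r, ((KeySet.node c l r).write b k).steps ≤ k + 1 := by
      intro c l r
      simp only [write_node, Cost.steps_bind, steps_tick]
      split_ifs with h1 h2
      · simp
      · have := ih ((k - 1) / 2) (by omega) l
        simp only [Cost.steps_bind, Cost.steps_pure]
        omega
      · have := ih ((k - 1) / 2) (by omega) r
        simp only [Cost.steps_bind, Cost.steps_pure]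
        omega
    cases t with
    | empty => rw [write_empty]; exact key _ _ _
    | node c l r => exact key c l r

theorem KeySet.not_mem_empty (k : ℕ) : ¬ KeySet.empty.Mem k := by simp [Mem, mem]

theorem KeySet.mem_node (k : ℕ) (b : Bool) (l r : KeySet) : (KeySet.node b l r).Mem k ↔
    if k = 0 then b = true else if k % 2 = 1 then l.Mem ((k - 1) / 2) else r.Mem ((k - 1) / 2) := by
  simp only [Mem, mem, Cost.val_bind]
  split_ifs <;> simp

/-- A non-zero number is determined by its parity and by `(k - 1) / 2`, so two numbers descend to
the same place only if they are equal. -/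
theorem KeySet.mem_write (b : Bool) (k j : ℕ) (t : KeySet) :
    (t.write b k).val.Mem j ↔ if j = k then b = true else t.Mem j := by
  induction k using Nat.strong_induction_on generalizing t j with
  | _ k ih =>
    have key : ∀ c l r, ((KeySet.node c l r).write b k).val.Mem j ↔
        if j = k then b = true else (KeySet.node c l r).Mem j := by
      intro c l r
      simp only [write_node, Cost.val_bind]
      split_ifs with h1 h2 h3 h4 h5
      · simp only [Cost.val_pure, mem_node]
        simp [h1, h2]
      · simp only [Cost.val_pure, mem_node]
        simp [h1 ▸ h2]
      · simp only [Cost.val_bind, Cost.val_pure, mem_node, h4, h1, h3, if_false, if_true,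
          ih ((k - 1) / 2) (by omega)]
      · simp only [Cost.val_bind, Cost.val_pure, mem_node, ih ((k - 1) / 2) (by omega)]
        split_ifs <;> first | rfl | omega
      · simp only [Cost.val_bind, Cost.val_pure, mem_node, h5, h1, h3, if_false, if_true,
          ih ((k - 1) / 2) (by omega)]
      · simp only [Cost.val_bind, Cost.val_pure, mem_node, ih ((k - 1) / 2) (by omega)]
        split_ifs <;> first | rfl | omega
    cases t with
    | empty =>
      have e : KeySet.empty.Mem j ↔ (KeySet.node false .empty .empty).Mem j := by
        rw [mem_node]
        simp [not_mem_empty]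
      rw [write_empty, e]
      exact key _ _ _
    | node c l r => exact key c l r

end KeySetLemmas

/-! ### Corners, their keys and their order -/

section CornerLemmas

/-- The minimum of the layer with index `u` (`0` if there is none). -/
noncomputable def loOf (A : Array (Layer ℝ)) (u : ℕ) : ℝ := A[u]?.elim 0 Layer.lo

/-- The maximum of the layer with index `u` (`0` if there is none). -/
noncomputable def hiOf (A : Array (Layer ℝ)) (u : ℕ) : ℝ := A[u]?.elim 0 Layer.hi

/-- The number of entries of the layer with index `u` (`0` if there is none). -/
def sizeOf (A : Array (Layer ℝ)) (u : ℕ) : ℕ := A[u]?.elim 0 fun a => a.entries.length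

/-- The number of elements of the layer product with index `p`. -/
def prodSizeOf (A B : Array (Layer ℝ)) (p : ℕ × ℕ) : ℕ := sizeOf A p.1 * sizeOf B p.2

/-- The minimum or maximum corner of the layer product `(u, v)`. -/
noncomputable def cornerOf (A B : Array (Layer ℝ)) (u v : ℕ) (b : Bool) : Corner ℝ :=
  corner (if b then hiOf A u + hiOf B v else loOf A u + loOf B v) u v b

/-- The indices of all layer products. -/
def allIndices (A B : Array (Layer ℝ)) : Finset (ℕ × ℕ) :=
  Finset.range A.size ×ˢ Finset.range B.size

theorem mem_allIndices {A B : Array (Layer ℝ)} {p : ℕ × ℕ} :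
    p ∈ allIndices A B ↔ p.1 < A.size ∧ p.2 < B.size := by
  simp [allIndices]

/-- All corners. -/
noncomputable def allCorners (A B : Array (Layer ℝ)) : Finset (Corner ℝ) :=
  (allIndices A B ×ˢ Finset.univ).image fun x => cornerOf A B x.1.1 x.1.2 x.2

theorem mem_allCorners {A B : Array (Layer ℝ)} {c : Corner ℝ} : c ∈ allCorners A B ↔
    ∃ u v b, u < A.size ∧ v < B.size ∧ c = cornerOf A B u v b := by
  simp only [allCorners, Finset.mem_image, Finset.mem_product, mem_allIndices, Finset.mem_univ,
    and_true, Prod.exists]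
  constructor
  · rintro ⟨u, v, b, ⟨h1, h2⟩, rfl⟩
    exact ⟨u, v, b, h1, h2, rfl⟩
  · rintro ⟨u, v, b, h1, h2, rfl⟩
    exact ⟨u, v, b, ⟨h1, h2⟩, rfl⟩

theorem card_allCorners_le (A B : Array (Layer ℝ)) :
    (allCorners A B).card ≤ 2 * A.size * B.size := by
  refine Finset.card_image_le.trans ?_
  simp [allIndices]
  nlinarith

@[simp] theorem index_cornerOf (A B : Array (Layer ℝ)) (u v : ℕ) (b : Bool) :
    Corner.index (cornerOf A B u v b) = (u, v) := rfl

@[simp] theorem isMax_cornerOf (A B : Array (Layer ℝ)) (u v : ℕ) (b : Bool) :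
    Corner.isMax (cornerOf A B u v b) = b := rfl

@[simp] theorem cornerOf_inj {A B : Array (Layer ℝ)} {u v u' v' : ℕ} {b b' : Bool} :
    cornerOf A B u v b = cornerOf A B u' v' b' ↔ u = u' ∧ v = v' ∧ b = b' := by
  constructor
  · intro h
    have h1 := congrArg Corner.index h
    have h2 := congrArg Corner.isMax h
    simp at h1 h2
    tauto
  · rintro ⟨rfl, rfl, rfl⟩
    rfl

theorem key_lt {m n u v : ℕ} (b : Bool) (hu : u < n) (hv : v < m) :
    key m u v b < 2 * n * m := by
  have : (u + 1) * m ≤ n * m := Nat.mul_le_mul_right m hu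
  rw [add_mul, one_mul] at this
  cases b <;> simp [key] <;> nlinarith

/-- Parity recovers the flag, and division with remainder by `m` recovers the index. -/
theorem key_inj {m u v u' v' : ℕ} {b b' : Bool} (hv : v < m) (hv' : v' < m)
    (h : key m u v b = key m u' v' b') : u = u' ∧ v = v' ∧ b = b' := by
  have hb : b = b' := by
    cases b <;> cases b' <;> simp [key] at h ⊢ <;> omega
  subst hb
  have h1 : u * m + v = u' * m + v' := by
    unfold key at h; omega
  have h2 : u = u' := by
    have := congrArg (· / m) h1
    simpa [Nat.add_div_of_dvd_right, Nat.div_eq_of_lt hv, Nat.div_eq_of_lt hv',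
      Nat.mul_div_cancel _ (show 0 < m by omega)] using this
  subst h2
  exact ⟨rfl, by omega, rfl⟩

/-- Ties between values are broken by the index and then by the flag, so weak inequalities of values
give the strict order of corners that the invariant needs. -/
theorem corner_lt_corner {x x' : ℝ} {u v u' v' : ℕ} {b b' : Bool} (hx : x ≤ x')
    (h : u < u' ∨ u = u' ∧ (v < v' ∨ v = v' ∧ b < b')) : corner x u v b < corner x' u' v' b' := by
  rw [corner, corner, Prod.Lex.toLex_lt_toLex]
  rcases hx.lt_or_eq with h' | h'
  · exact Or.inl h'
  · refine Or.inr ⟨h', ?_⟩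
    rw [Prod.Lex.toLex_lt_toLex]
    simp only [Prod.Lex.toLex_lt_toLex, EmbeddingLike.apply_eq_iff_eq, Prod.mk.injEq]
    tauto

theorem value_le_of_corner_le {x x' : ℝ} {u v u' v' : ℕ} {b b' : Bool}
    (h : corner x u v b ≤ corner x' u' v' b') : x ≤ x' := by
  rw [corner, corner, Prod.Lex.toLex_le_toLex] at h
  rcases h with h | h
  exacts [h.le, h.1.le]

/-- The layers of a non-empty layer-ordered heap, the first of which has one entry. -/
structure OrderedLayers (A : Array (Layer ℝ)) : Prop where
  pos : 0 < A.size
  hi_le_lo : ∀ u v, u < v → v < A.size → hiOf A u ≤ loOf A v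
  lo_le_hi : ∀ u, loOf A u ≤ hiOf A u
  hi_zero : hiOf A 0 = loOf A 0
  size_eq : ∀ u (h : u < A.size), A[u].size = A[u].entries.length

variable {A B : Array (Layer ℝ)}

theorem OrderedLayers.lo_le_lo_succ (hA : OrderedLayers A) {u : ℕ} (hu : u + 1 < A.size) :
    loOf A u ≤ loOf A (u + 1) :=
  (hA.lo_le_hi u).trans (hA.hi_le_lo _ _ (Nat.lt_succ_self u) hu)

/-- For `u = 0` the subtraction truncates and the claim becomes `hiOf A 0 ≤ loOf A 0`, which holds
because the first layer has a single entry. -/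
theorem OrderedLayers.hi_pred_le_lo (hA : OrderedLayers A) {u : ℕ} (hu : u < A.size) :
    hiOf A (u - 1) ≤ loOf A u := by
  cases u with
  | zero => exact hA.hi_zero.le
  | succ u => exact hA.hi_le_lo _ _ (Nat.lt_succ_self u) hu

theorem cornerOf_min_lt_max (hA : OrderedLayers A) (hB : OrderedLayers B) (u v : ℕ) :
    cornerOf A B u v false < cornerOf A B u v true :=
  corner_lt_corner (by simpa using add_le_add (hA.lo_le_hi u) (hB.lo_le_hi v)) (by simp)

theorem cornerOf_lt_succ_left (hA : OrderedLayers A) {u : ℕ} (hu : u + 1 < A.size) (v : ℕ) :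
    cornerOf A B u v false < cornerOf A B (u + 1) v false :=
  corner_lt_corner (by simpa using hA.lo_le_lo_succ hu) (by simp)

theorem cornerOf_lt_succ_right (hB : OrderedLayers B) (u : ℕ) {v : ℕ} (hv : v + 1 < B.size) :
    cornerOf A B u v false < cornerOf A B u (v + 1) false :=
  corner_lt_corner (by simpa using hB.lo_le_lo_succ hv) (by simp)

/-- The diagonal comparison behind the `O(k)` bound: once the minimum of a product is popped, the
maximum of its diagonal predecessor has been popped too. -/
theorem cornerOf_pred_lt (hA : OrderedLayers A) (hB : OrderedLayers B) {u v : ℕ}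
    (hu : u < A.size) (hv : v < B.size) (h : (u, v) ≠ (0, 0)) :
    cornerOf A B (u - 1) (v - 1) true < cornerOf A B u v false := by
  refine corner_lt_corner (by simpa using add_le_add (hA.hi_pred_le_lo hu) (hB.hi_pred_le_lo hv)) ?_
  simp at h
  omega

end CornerLemmas

/-! ### Inserting a corner -/

section PhaseOne

variable {A B : Array (Layer ℝ)}

/-- The heap of the state `st` holds the corners `H`, and its set of keys is up to date. -/
structure HoldsHeap (A B : Array (Layer ℝ)) (st : State ℝ) (H : Finset (Corner ℝ)) : Prop where
  isHeap : st.heap.IsHeap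
  elems : st.heap.elems = H.val
  keys : ∀ u < A.size, ∀ v < B.size, ∀ b,
    st.inHeap.Mem (key B.size u v b) ↔ cornerOf A B u v b ∈ H
  subset : H ⊆ allCorners A B

/-- The corners `H` together with the corner of `(u, v)`, if there is such a layer product. -/
noncomputable def insertValid (A B : Array (Layer ℝ)) (u v : ℕ) (b : Bool) (H : Finset (Corner ℝ)) :
    Finset (Corner ℝ) :=
  if u < A.size ∧ v < B.size then insert (cornerOf A B u v b) H else H

theorem mem_insertValid {u v : ℕ} {b : Bool} {H : Finset (Corner ℝ)} {c : Corner ℝ} :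
    c ∈ insertValid A B u v b H ↔
      (u < A.size ∧ v < B.size ∧ c = cornerOf A B u v b) ∨ c ∈ H := by
  unfold insertValid
  split_ifs with h
  · simp [h]
  · constructor
    · exact Or.inr
    · rintro (⟨h1, h2, -⟩ | h')
      exacts [absurd ⟨h1, h2⟩ h, h']

/-- On the level of sets, duplicate checks and missing products disappear into `insertValid`. The
counter grows exactly when the set does, hence the balance of cardinalities. The three terms of the
cost are lookup, heap insertion and key insertion. -/
theorem insertCorner_spec {st : State ℝ} {H : Finset (Corner ℝ)} (h : HoldsHeap A B st H)
    (u v : ℕ) (b : Bool) :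
    HoldsHeap A B (insertCorner A B u v b st).val (insertValid A B u v b H) ∧
      (insertCorner A B u v b st).val.q = st.q ∧ (insertCorner A B u v b st).val.s = st.s ∧
      (insertCorner A B u v b st).val.corners + H.card =
        st.corners + (insertValid A B u v b H).card ∧
      (insertCorner A B u v b st).steps ≤ 3 * (2 * A.size * B.size) + 2 := by
  unfold insertValid
  by_cases hv : u < A.size ∧ v < B.size
  · obtain ⟨hu, hv⟩ := hv
    have e1 : A[u]? = some A[u] := Array.getElem?_eq_getElem hu
    have e2 : B[v]? = some B[v] := Array.getElem?_eq_getElem hv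
    have hk := key_lt b hu hv
    have hm := KeySet.steps_mem_le (key B.size u v b) st.inHeap
    by_cases hc : st.inHeap.Mem (key B.size u v b)
    · have hc' := (h.keys u hu v hv b).1 hc
      unfold KeySet.Mem at hc
      simp only [insertCorner, e1, e2, Cost.val_bind, Cost.steps_bind, steps_tick, hc, if_true,
        Cost.val_pure, Cost.steps_pure, hu, hv, and_self, Finset.insert_eq_of_mem hc', h, true_and]
      omega
    · have hc' := mt (h.keys u hu v hv b).2 hc
      have hmem := KeySet.mem_write true (key B.size u v b) (t := st.inHeap)
      have hx : (if b = true then A[u].hi + B[v].hi else A[u].lo + B[v].lo) =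
          if b = true then hiOf A u + hiOf B v else loOf A u + loOf B v := by
        simp [hiOf, loOf, e1, e2]
      unfold KeySet.Mem at hc
      obtain ⟨p1, p2, p3⟩ := Tree.push_spec (cornerOf A B u v b) st.heap
      have hw := KeySet.steps_write_le true (key B.size u v b) st.inHeap
      have hcard : st.heap.elems.card ≤ 2 * A.size * B.size := by
        rw [h.elems]
        exact (Finset.card_le_card h.subset).trans (card_allCorners_le A B)
      simp only [insertCorner, e1, e2, Cost.val_bind, Cost.steps_bind, steps_tick, hc, if_false,
        Cost.val_pure, Cost.steps_pure, hu, hv, and_self, if_true, true_and, hx,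
        Finset.card_insert_of_notMem hc', Bool.false_eq_true]
      refine ⟨⟨p2 h.isHeap, ?_, ?_, ?_⟩, by omega, ?_⟩
      · rw [Finset.insert_val_of_notMem hc', ← h.elems]
        exact p1
      · intro u' hu' v' hv' b'
        rw [hmem, Finset.mem_insert, cornerOf_inj]
        split_ifs with h1
        · simp [key_inj hv' hv h1]
        · rw [h.keys u' hu' v' hv']
          constructor
          · exact Or.inr
          · rintro (⟨rfl, rfl, rfl⟩ | h2)
            exacts [absurd rfl h1, h2]
      · exact Finset.insert_subset (mem_allCorners.2 ⟨u, v, b, hu, hv, rfl⟩) h.subset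
      · unfold cornerOf at p3
        omega
  · have e : insertCorner A B u v b st = (do tick; return st) := by
      unfold insertCorner
      congr 1
      funext _
      split
      · next a b e1 e2 =>
        exact absurd ⟨(Array.getElem?_eq_some_iff.1 e1).1, (Array.getElem?_eq_some_iff.1 e2).1⟩ hv
      · rfl
    simp only [e, hv, if_false, Cost.val_bind, Cost.val_pure, Cost.steps_bind, Cost.steps_pure,
      steps_tick, h, true_and]
    omega

end PhaseOne

/-! ### The invariant of phase 1 -/

section PhaseOneInvariant

variable {A B : Array (Layer ℝ)}

theorem productSize_spec (hA : OrderedLayers A) (hB : OrderedLayers B) {p : ℕ × ℕ}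
    (hp : p ∈ allIndices A B) : productSize A B p = ⟨prodSizeOf A B p, 1⟩ := by
  obtain ⟨h1, h2⟩ := mem_allIndices.1 hp
  have e1 : A[p.1]? = some A[p.1] := Array.getElem?_eq_getElem h1
  have e2 : B[p.2]? = some B[p.2] := Array.getElem?_eq_getElem h2
  simp only [productSize, e1, e2, prodSizeOf, sizeOf, Option.elim, hA.size_eq _ h1,
    hB.size_eq _ h2]
  rfl

/-- The invariant of phase 1: the corners `P` have been popped, the corners `H` are in the heap. -/
structure Invariant (A B : Array (Layer ℝ)) (st : State ℝ) (P H : Finset (Corner ℝ)) : Prop where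
  holds : HoldsHeap A B st H
  subset : P ⊆ allCorners A B
  lt : ∀ p ∈ P, ∀ h ∈ H, p < h
  corners_eq : st.corners = P.card + H.card
  nodup : st.q.Nodup
  mem_q : ∀ p, p ∈ st.q ↔ p ∈ allIndices A B ∧ cornerOf A B p.1 p.2 true ∈ P
  s_eq : st.s = (st.q.map (prodSizeOf A B)).sum
  zero : cornerOf A B 0 0 false ∈ P ∪ H
  left : ∀ u v, u + 1 < A.size → v < B.size → cornerOf A B u v false ∈ P →
    cornerOf A B (u + 1) v false ∈ P ∪ H
  right : ∀ u v, u < A.size → v + 1 < B.size → cornerOf A B u v false ∈ P →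
    cornerOf A B u (v + 1) false ∈ P ∪ H
  max : ∀ u v, u < A.size → v < B.size →
    (cornerOf A B u v true ∈ P ∪ H ↔ cornerOf A B u v false ∈ P)

theorem Invariant.disjoint {st : State ℝ} {P H : Finset (Corner ℝ)} (h : Invariant A B st P H) :
    Disjoint P H :=
  Finset.disjoint_left.2 fun c h1 h2 => lt_irrefl _ (h.lt c h1 c h2)

theorem Invariant.card_le {st : State ℝ} {P H : Finset (Corner ℝ)} (h : Invariant A B st P H) :
    P.card + H.card ≤ 2 * A.size * B.size := by
  rw [← Finset.card_union_of_disjoint h.disjoint]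
  exact (Finset.card_le_card (Finset.union_subset h.subset h.holds.subset)).trans
    (card_allCorners_le A B)

/-- A corner that has not been popped is bounded below by some corner in the heap. -/
theorem Invariant.exists_le (hA : OrderedLayers A) (hB : OrderedLayers B) {st : State ℝ}
    {P H : Finset (Corner ℝ)} (h : Invariant A B st P H) {c : Corner ℝ}
    (hc : c ∈ allCorners A B) (hP : c ∉ P) : ∃ d ∈ H, d ≤ c := by
  -- Walk back along the first coordinate, and in row `0` along the second. If the preceding minimum
  -- was popped, the corner itself is in the heap; otherwise a heap corner below the preceding
  -- minimum also serves here.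
  have hmin : ∀ u v, u < A.size → v < B.size → cornerOf A B u v false ∉ P →
      ∃ d ∈ H, d ≤ cornerOf A B u v false := by
    intro u v
    have base : ∀ {u v}, cornerOf A B u v false ∈ P ∪ H → cornerOf A B u v false ∉ P →
        ∃ d ∈ H, d ≤ cornerOf A B u v false := fun h1 h2 =>
      ⟨_, (Finset.mem_union.1 h1).resolve_left h2, le_rfl⟩
    induction u with
    | zero =>
      induction v with
      | zero => exact fun _ _ hn => base h.zero hn
      | succ v ih =>
        intro hu hv hn
        by_cases hp : cornerOf A B 0 v false ∈ P
        · exact base (h.right 0 v hu hv hp) hn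
        · obtain ⟨d, h1, h2⟩ := ih hu (by omega) hp
          exact ⟨d, h1, h2.trans (cornerOf_lt_succ_right hB 0 hv).le⟩
    | succ u ih =>
      intro hu hv hn
      by_cases hp : cornerOf A B u v false ∈ P
      · exact base (h.left u v hu hv hp) hn
      · obtain ⟨d, h1, h2⟩ := ih (by omega) hv hp
        exact ⟨d, h1, h2.trans (cornerOf_lt_succ_left hA hu v).le⟩
  obtain ⟨u, v, b, hu, hv, rfl⟩ := mem_allCorners.1 hc
  cases b with
  | false => exact hmin u v hu hv hP
  | true =>
    by_cases hp : cornerOf A B u v false ∈ P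
    · exact ⟨_, (Finset.mem_union.1 ((h.max u v hu hv).2 hp)).resolve_left hP, le_rfl⟩
    · obtain ⟨d, h1, h2⟩ := hmin u v hu hv hp
      exact ⟨d, h1, h2.trans (cornerOf_min_lt_max hA hB u v).le⟩

/-- The popped corners form a lower set. -/
theorem Invariant.mem_of_lt (hA : OrderedLayers A) (hB : OrderedLayers B) {st : State ℝ}
    {P H : Finset (Corner ℝ)} (h : Invariant A B st P H) {c d : Corner ℝ}
    (hc : c ∈ allCorners A B) (hd : d ∈ P) (hcd : c < d) : c ∈ P := by
  by_contra hn
  obtain ⟨e, h1, h2⟩ := h.exists_le hA hB hc hn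
  exact lt_irrefl _ ((h.lt d hd e h1).trans_le (h2.trans hcd.le))

theorem HoldsHeap.pop {st : State ℝ} {H : Finset (Corner ℝ)} (h : HoldsHeap A B st H)
    {u v : ℕ} {b : Bool} {t : Tree (Corner ℝ)} (hv : v < B.size)
    (ht : st.heap.elems = cornerOf A B u v b ::ₘ t.elems) (hh : t.IsHeap) (s q) :
    HoldsHeap A B ⟨t, (st.inHeap.write false (key B.size u v b)).val, s, q, st.corners⟩
      (H.erase (cornerOf A B u v b)) := by
  refine ⟨hh, ?_, ?_, (Finset.erase_subset _ _).trans h.subset⟩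
  · rw [Finset.erase_val, ← h.elems, ht, Multiset.erase_cons_head]
  · intro u' hu' v' hv' b'
    rw [KeySet.mem_write, Finset.mem_erase]
    split_ifs with h1
    · simp [key_inj hv' hv h1]
    · rw [h.keys u' hu' v' hv', Ne, cornerOf_inj]
      constructor
      · exact fun h2 => ⟨fun ⟨h3, h4, h5⟩ => h1 (by rw [h3, h4, h5]), h2⟩
      · exact And.right

/-- The corner only moves from `H` to `P`: the union and the set of popped minima are unchanged, so
the closure conditions carry over. -/
theorem process_max_spec (hA : OrderedLayers A) (hB : OrderedLayers B) {st : State ℝ}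
    {P H : Finset (Corner ℝ)} (h : Invariant A B st P H) {u v : ℕ} {t : Tree (Corner ℝ)}
    (hu : u < A.size) (hv : v < B.size)
    (ht : st.heap.elems = cornerOf A B u v true ::ₘ t.elems) (hh : t.IsHeap)
    (hmin : ∀ c ∈ H, cornerOf A B u v true ≤ c) :
    Invariant A B (process A B (cornerOf A B u v true) t st).val
      (insert (cornerOf A B u v true) P) (H.erase (cornerOf A B u v true)) ∧
      (process A B (cornerOf A B u v true) t st).val.s = st.s + prodSizeOf A B (u, v) ∧
      (process A B (cornerOf A B u v true) t st).steps ≤ 2 * A.size * B.size + 3 := by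
  have hp : (u, v) ∈ allIndices A B := mem_allIndices.2 ⟨hu, hv⟩
  have e1 : (process A B (cornerOf A B u v true) t st).val =
      ⟨t, (st.inHeap.write false (key B.size u v true)).val, (u, v) :: st.q,
        st.s + prodSizeOf A B (u, v), st.corners⟩ := by
    simp only [process, Cost.val_bind, index_cornerOf, isMax_cornerOf, if_true,
      productSize_spec hA hB hp, Cost.val_pure]
  have e2 : (process A B (cornerOf A B u v true) t st).steps =
      (st.inHeap.write false (key B.size u v true)).steps + 2 := by
    simp only [process, Cost.steps_bind, steps_tick, index_cornerOf, isMax_cornerOf, if_true,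
      productSize_spec hA hB hp, Cost.steps_pure]
    omega
  have hk := key_lt true hu hv
  have hw := KeySet.steps_write_le false (key B.size u v true) st.inHeap
  have hcH : cornerOf A B u v true ∈ H := by
    rw [← Finset.mem_val, ← h.holds.elems, ht]
    exact Multiset.mem_cons_self _ _
  have hcP : cornerOf A B u v true ∉ P := fun hc => Finset.disjoint_left.1 h.disjoint hc hcH
  have hU : insert (cornerOf A B u v true) P ∪ H.erase (cornerOf A B u v true) = P ∪ H := by
    ext c
    simp only [Finset.mem_union, Finset.mem_insert, Finset.mem_erase]
    constructor
    · rintro ((rfl | h) | h)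
      exacts [Or.inr hcH, Or.inl h, Or.inr h.2]
    · tauto
  rw [e1, e2]
  refine ⟨⟨h.holds.pop hv ht hh _ _, ?_, ?_, ?_, ?_, ?_, ?_, ?_, ?_, ?_, ?_⟩, rfl, by omega⟩
  · exact Finset.insert_subset (h.holds.subset hcH) h.subset
  · intro p hp d hd
    obtain ⟨h1, h2⟩ := Finset.mem_erase.1 hd
    rcases Finset.mem_insert.1 hp with rfl | hp
    · exact lt_of_le_of_ne (hmin d h2) h1.symm
    · exact h.lt p hp d h2
  · rw [Finset.card_insert_of_notMem hcP, Finset.card_erase_of_mem hcH]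
    have := Finset.card_pos.2 ⟨_, hcH⟩
    have := h.corners_eq
    simp only
    omega
  · exact List.nodup_cons.2 ⟨fun hc => hcP ((h.mem_q _).1 hc).2, h.nodup⟩
  · rintro ⟨u', v'⟩
    rw [List.mem_cons, Finset.mem_insert, h.mem_q, cornerOf_inj, Prod.mk.injEq]
    constructor
    · rintro (⟨rfl, rfl⟩ | h1)
      · exact ⟨hp, by simp⟩
      · exact ⟨h1.1, Or.inr h1.2⟩
    · tauto
  · simp [h.s_eq, add_comm]
  · rw [hU]; exact h.zero
  · intro u' v' hu' hv' h'
    rw [hU]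
    exact h.left u' v' hu' hv' ((Finset.mem_insert.1 h').resolve_left (by simp))
  · intro u' v' hu' hv' h'
    rw [hU]
    exact h.right u' v' hu' hv' ((Finset.mem_insert.1 h').resolve_left (by simp))
  · intro u' v' hu' hv'
    rw [hU, h.max u' v' hu' hv']
    simp

/-- All three inserted corners exceed the popped one, which exceeds all of `P`. So `P` stays below
the heap and no popped corner is inserted again. -/
theorem process_min_spec (hA : OrderedLayers A) (hB : OrderedLayers B) {st : State ℝ}
    {P H : Finset (Corner ℝ)} (h : Invariant A B st P H) {u v : ℕ} {t : Tree (Corner ℝ)}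
    (hu : u < A.size) (hv : v < B.size)
    (ht : st.heap.elems = cornerOf A B u v false ::ₘ t.elems) (hh : t.IsHeap)
    (hmin : ∀ c ∈ H, cornerOf A B u v false ≤ c) :
    (∃ H', Invariant A B (process A B (cornerOf A B u v false) t st).val
      (insert (cornerOf A B u v false) P) H') ∧
      (process A B (cornerOf A B u v false) t st).val.s = st.s ∧
      (process A B (cornerOf A B u v false) t st).steps ≤ 10 * (2 * A.size * B.size) + 8 := by
  set c := cornerOf A B u v false with hcdef
  have hk := key_lt false hu hv
  have hw := KeySet.steps_write_le false (key B.size u v false) st.inHeap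
  have hcH : c ∈ H := by
    rw [← Finset.mem_val, ← h.holds.elems, ht]
    exact Multiset.mem_cons_self _ _
  have hcP : c ∉ P := fun hc => Finset.disjoint_left.1 h.disjoint hc hcH
  have i0 := h.holds.pop hv ht hh st.q st.s
  set st1 : State ℝ := ⟨t, (st.inHeap.write false (key B.size u v false)).val, st.q, st.s,
    st.corners⟩ with hst1
  obtain ⟨i1, q1, s1, c1, t1⟩ := insertCorner_spec i0 (u + 1) v false
  set H1 := insertValid A B (u + 1) v false (H.erase c) with hH1
  set st2 := (insertCorner A B (u + 1) v false st1).val with hst2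
  obtain ⟨i2, q2, s2, c2, t2⟩ := insertCorner_spec i1 u (v + 1) false
  set H2 := insertValid A B u (v + 1) false H1 with hH2
  set st3 := (insertCorner A B u (v + 1) false st2).val with hst3
  obtain ⟨i3, q3, s3, c3, t3⟩ := insertCorner_spec i2 u v true
  set H3 := insertValid A B u v true H2 with hH3
  have e1 : (process A B c t st).val = (insertCorner A B u v true st3).val := by
    simp only [process, Cost.val_bind, hcdef, index_cornerOf, isMax_cornerOf, Bool.false_eq_true,
      if_false, hst1, hst2, hst3]
  have e2 : (process A B c t st).steps = 1 + ((st.inHeap.write false (key B.size u v false)).steps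
      + ((insertCorner A B (u + 1) v false st1).steps + ((insertCorner A B u (v + 1) false st2).steps
        + (insertCorner A B u v true st3).steps))) := by
    simp only [process, Cost.steps_bind, hcdef, index_cornerOf, isMax_cornerOf, Bool.false_eq_true,
      if_false, hst1, hst2, hst3, steps_tick]
  have hmem : ∀ d, d ∈ H3 ↔ d = cornerOf A B u v true ∨
      (v + 1 < B.size ∧ d = cornerOf A B u (v + 1) false) ∨
      (u + 1 < A.size ∧ d = cornerOf A B (u + 1) v false) ∨ (d ≠ c ∧ d ∈ H) := by
    intro d
    rw [hH3, hH2, hH1, mem_insertValid, mem_insertValid, mem_insertValid, Finset.mem_erase]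
    tauto
  clear_value H3 H2 H1 st3 st2 st1
  have hlt : ∀ d ∈ H3, c < d := by
    intro d hd
    rcases (hmem d).1 hd with rfl | ⟨h1, rfl⟩ | ⟨h1, rfl⟩ | ⟨h1, h2⟩
    · exact cornerOf_min_lt_max hA hB u v
    · exact cornerOf_lt_succ_right hB u h1
    · exact cornerOf_lt_succ_left hA h1 v
    · exact lt_of_le_of_ne (hmin d h2) h1.symm
  have hU : P ∪ H ⊆ insert c P ∪ H3 := by
    intro d hd
    rw [Finset.mem_union, Finset.mem_insert, hmem]
    rcases Finset.mem_union.1 hd with h1 | h1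
    · exact Or.inl (Or.inr h1)
    · by_cases h2 : d = c
      · exact Or.inl (Or.inl h2)
      · tauto
  rw [e1, e2]
  have hq : (insertCorner A B u v true st3).val.q = st.q := by rw [q3, q2, q1, hst1]
  have hs : (insertCorner A B u v true st3).val.s = st.s := by rw [s3, s2, s1, hst1]
  refine ⟨⟨H3, i3, ?_, ?_, ?_, ?_, ?_, ?_, ?_, ?_, ?_, ?_⟩, hs, by omega⟩
  · exact Finset.insert_subset (h.holds.subset hcH) h.subset
  · intro p hp d hd
    rcases Finset.mem_insert.1 hp with rfl | hp
    · exact hlt d hd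
    · exact (h.lt p hp c hcH).trans (hlt d hd)
  · rw [Finset.card_insert_of_notMem hcP]
    rw [Finset.card_erase_of_mem hcH] at c1
    have := Finset.card_pos.2 ⟨_, hcH⟩
    have := h.corners_eq
    have : st1.corners = st.corners := by rw [hst1]
    omega
  · rw [hq]; exact h.nodup
  · intro p
    rw [hq, h.mem_q, Finset.mem_insert, hcdef, cornerOf_inj]
    simp
  · rw [hs, hq]; exact h.s_eq
  · exact hU h.zero
  · intro u' v' hu' hv' h'
    rcases Finset.mem_insert.1 h' with h1 | h1
    · obtain ⟨rfl, rfl, -⟩ := cornerOf_inj.1 h1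
      exact Finset.mem_union_right _ ((hmem _).2 (Or.inr (Or.inr (Or.inl ⟨hu', rfl⟩))))
    · exact hU (h.left u' v' hu' hv' h1)
  · intro u' v' hu' hv' h'
    rcases Finset.mem_insert.1 h' with h1 | h1
    · obtain ⟨rfl, rfl, -⟩ := cornerOf_inj.1 h1
      exact Finset.mem_union_right _ ((hmem _).2 (Or.inr (Or.inl ⟨hv', rfl⟩)))
    · exact hU (h.right u' v' hu' hv' h1)
  · intro u' v' hu' hv'
    have := h.max u' v' hu' hv'
    rw [Finset.mem_union] at this
    rw [Finset.mem_union, Finset.mem_insert, Finset.mem_insert, hmem, hcdef, ← this]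
    simp only [cornerOf_inj, Bool.true_eq_false, and_false, false_or, ne_eq, not_false_eq_true,
      true_and, and_true]
    tauto

/-- If phase 1 has stopped, then it stopped as soon as there were enough elements: the last popped
corner is the maximum of a layer product without which there were less than `k` elements. -/
def StopsAt (A B : Array (Layer ℝ)) (k : ℕ) (st : State ℝ) (P : Finset (Corner ℝ)) : Prop :=
  st.s < k ∨ ∃ u v, u < A.size ∧ v < B.size ∧ cornerOf A B u v true ∈ P ∧
    (∀ p ∈ P, p ≤ cornerOf A B u v true) ∧ st.s < k + prodSizeOf A B (u, v)

/-- With nothing in the heap, no corner can be unpopped, since it would need a heap corner below it.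
So every product has been counted. -/
theorem Invariant.le_s_of_empty (hA : OrderedLayers A) (hB : OrderedLayers B) {st : State ℝ}
    {P : Finset (Corner ℝ)} (h : Invariant A B st P ∅) :
    st.s = ∑ p ∈ allIndices A B, prodSizeOf A B p := by
  rw [h.s_eq, ← List.sum_toFinset _ h.nodup]
  congr 1
  ext p
  rw [List.mem_toFinset, h.mem_q]
  refine and_iff_left_of_imp fun hp => ?_
  obtain ⟨h1, h2⟩ := mem_allIndices.1 hp
  by_contra hn
  obtain ⟨d, hd, -⟩ := h.exists_le hA hB (mem_allCorners.2 ⟨p.1, p.2, true, h1, h2, rfl⟩) hn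
  simp at hd

/-- Each round adds one corner to `P`, so `fuel + P.card` is preserved; as `P` never exceeds the
number of corners, the fuel does not run out. -/
theorem popLoop_spec (hA : OrderedLayers A) (hB : OrderedLayers B) {k : ℕ}
    (hk : k ≤ ∑ p ∈ allIndices A B, prodSizeOf A B p) (fuel : ℕ) (st : State ℝ)
    (P H : Finset (Corner ℝ)) (h : Invariant A B st P H) (hst : StopsAt A B k st P)
    (hf : 2 * A.size * B.size + 1 ≤ fuel + P.card) :
    (∃ P' H', Invariant A B (popLoop A B k fuel st).val P' H' ∧
      StopsAt A B k (popLoop A B k fuel st).val P' ∧ k ≤ (popLoop A B k fuel st).val.s) ∧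
      (popLoop A B k fuel st).steps ≤ fuel * (12 * (2 * A.size * B.size) + 11) + 1 := by
  have hcard := h.card_le
  induction fuel generalizing st P H with
  | zero => omega
  | succ fuel ih =>
    simp only [popLoop, Cost.val_bind, Cost.steps_bind, steps_tick]
    by_cases hks : k ≤ st.s
    · simp only [hks, if_true, Cost.val_pure, Cost.steps_pure]
      exact ⟨⟨P, H, h, hst, trivial⟩, by omega⟩
    · simp only [hks, if_false, Cost.val_bind, Cost.steps_bind]
      obtain ⟨p1, p2, p3⟩ := Tree.pop_spec st.heap h.holds.isHeap
      rw [h.holds.elems, Finset.card_val] at p3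
      rcases hp : st.heap.pop.val with _ | ⟨c, t⟩
      · exfalso
        have := p1 hp
        rw [h.holds.elems, Finset.val_eq_zero] at this
        subst this
        have := h.le_s_of_empty hA hB
        omega
      · obtain ⟨i1, i2, i3⟩ := p2 c t hp
        have hcH : c ∈ H := by
          rw [← Finset.mem_val, ← h.holds.elems, i1]
          exact Multiset.mem_cons_self _ _
        have hcP : c ∉ P := fun hc => Finset.disjoint_left.1 h.disjoint hc hcH
        have hmin : ∀ d ∈ H, c ≤ d := fun d hd => i3 d (by rw [h.holds.elems]; exact hd)
        obtain ⟨u, v, b, hu, hv, rfl⟩ := mem_allCorners.1 (h.holds.subset hcH)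
        have hci := Finset.card_insert_of_notMem hcP
        simp only
        cases b with
        | false =>
          obtain ⟨⟨H', j1⟩, j2, j3⟩ := process_min_spec hA hB h hu hv i1 i2 hmin
          obtain ⟨k1, k2⟩ := ih _ _ _ j1 (Or.inl (by omega)) (by omega) j1.card_le
          refine ⟨k1, ?_⟩
          rw [Cost.steps_bind, add_mul]
          omega
        | true =>
          obtain ⟨j1, j2, j3⟩ := process_max_spec hA hB h hu hv i1 i2 hmin
          have hlast : ∀ p ∈ insert (cornerOf A B u v true) P, p ≤ cornerOf A B u v true := by
            intro p hp
            rcases Finset.mem_insert.1 hp with rfl | hp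
            exacts [le_rfl, (h.lt p hp _ hcH).le]
          -- Before this round `s` was below `k`, so without the product just added it still is; and
          -- the corner just popped is the largest of `P`.
          obtain ⟨k1, k2⟩ := ih _ _ _ j1
            (Or.inr ⟨u, v, hu, hv, Finset.mem_insert_self _ _, hlast, by omega⟩) (by omega)
            j1.card_le
          refine ⟨k1, ?_⟩
          rw [Cost.steps_bind, add_mul]
          omega

theorem phase1_spec (hA : OrderedLayers A) (hB : OrderedLayers B) {k : ℕ} (hk1 : 1 ≤ k)
    (hk : k ≤ ∑ p ∈ allIndices A B, prodSizeOf A B p) :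
    (∃ P H, Invariant A B (phase1 A B k).val P H ∧
      StopsAt A B k (phase1 A B k).val P ∧ k ≤ (phase1 A B k).val.s) ∧
      (phase1 A B k).steps ≤ 20 * (2 * A.size * B.size + 1) ^ 2 := by
  have h0 : HoldsHeap A B ⟨.leaf, .empty, [], 0, 0⟩ ∅ :=
    ⟨trivial, rfl, fun u _ v _ b => by simp [KeySet.not_mem_empty], by simp⟩
  obtain ⟨i1, q1, s1, c1, t1⟩ := insertCorner_spec h0 0 0 false
  have e : insertValid A B 0 0 false ∅ = {cornerOf A B 0 0 false} := by
    simp [insertValid, hA.pos, hB.pos]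
  rw [e] at i1 c1
  have hI : Invariant A B (insertCorner A B 0 0 false ⟨.leaf, .empty, [], 0, 0⟩).val ∅
      {cornerOf A B 0 0 false} := by
    refine ⟨i1, by simp, by simp, by simpa using c1, by simp [q1], by simp [q1], by simp [q1, s1],
      by simp, by simp, by simp, by simp⟩
  obtain ⟨k1, k2⟩ := popLoop_spec hA hB hk (2 * A.size * B.size + 1) _ _ _ hI
    (Or.inl (by rw [s1]; exact hk1)) (by simp)
  refine ⟨k1, ?_⟩
  simp only [phase1, Cost.steps_bind, steps_tick]
  nlinarith

end PhaseOneInvariant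

/-! ### Phase 2 and the bound on the number of candidates -/

section PhaseTwo

variable {A B : Array (Layer ℝ)}

theorem collect_spec (hA : OrderedLayers A) (hB : OrderedLayers B) (t : Tree (Corner ℝ))
    (ht : ∀ c ∈ t.elems, c ∈ allCorners A B) (acc : List (ℕ × ℕ) × ℕ) :
    (∃ L : List (ℕ × ℕ),
      (collect A B t acc).val = (L ++ acc.1, acc.2 + (L.map (prodSizeOf A B)).sum) ∧
      (L : Multiset (ℕ × ℕ)) =
        (t.elems.filter fun c => Corner.isMax c = true).map Corner.index) ∧
      (collect A B t acc).steps ≤ 3 * t.elems.card + 1 := by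
  induction t generalizing acc with
  | leaf => exact ⟨⟨[], by simp [collect], by simp [Tree.elems]⟩, by simp [collect]⟩
  | node l c r ihl ihr =>
    obtain ⟨⟨L1, i1, i2⟩, i3⟩ := ihl (fun c hc => ht c (by simp [Tree.elems, hc])) acc
    obtain ⟨⟨L2, j1, j2⟩, j3⟩ := ihr (fun c hc => ht c (by simp [Tree.elems, hc]))
      (L1 ++ acc.1, acc.2 + (L1.map (prodSizeOf A B)).sum)
    obtain ⟨u, v, b, hu, hv, rfl⟩ := mem_allCorners.1 (ht c (by simp [Tree.elems]))
    have hp := productSize_spec hA hB ((mem_allIndices (p := (u, v))).2 ⟨hu, hv⟩)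
    simp only [collect, Cost.val_bind, Cost.steps_bind, steps_tick, i1, j1, isMax_cornerOf,
      index_cornerOf, Tree.elems, Multiset.card_cons, Multiset.card_add]
    cases b with
    | true =>
      simp only [if_true, Cost.val_bind, Cost.steps_bind, hp, Cost.val_pure, Cost.steps_pure]
      refine ⟨⟨(u, v) :: L2 ++ L1, ?_, ?_⟩, by omega⟩
      · simp; omega
      · rw [Multiset.filter_cons_of_pos _ (by simp), Multiset.map_cons, Multiset.filter_add,
          Multiset.map_add, ← i2, ← j2]
        simp [List.perm_append_comm]
    | false =>
      simp only [Bool.false_eq_true, if_false, Cost.val_pure, Cost.steps_pure]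
      refine ⟨⟨L2 ++ L1, ?_, ?_⟩, by omega⟩
      · simp; omega
      · rw [Multiset.filter_cons_of_neg _ (by simp), Multiset.filter_add,
          Multiset.map_add, ← i2, ← j2]
        simp [List.perm_append_comm]

/-- The final list collects the maxima in `P` and those in `H`; by the field `max` of the invariant
these belong to the products whose minimum is in `P`. Disjointness of `P` and `H` excludes
repetitions. -/
theorem phase2_spec (hA : OrderedLayers A) (hB : OrderedLayers B) {st : State ℝ}
    {P H : Finset (Corner ℝ)} (h : Invariant A B st P H) :
    (∃ q s', (phase2 A B st).val = (q, s') ∧ q.Nodup ∧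
      (∀ p, p ∈ q ↔ p ∈ allIndices A B ∧ cornerOf A B p.1 p.2 false ∈ P) ∧
      (q.map (prodSizeOf A B)).sum = st.s + s') ∧
      (phase2 A B st).steps ≤ 3 * (2 * A.size * B.size) + 2 := by
  have hsub : ∀ c ∈ st.heap.elems, c ∈ allCorners A B := by
    rw [h.holds.elems]
    exact fun c hc => h.holds.subset hc
  obtain ⟨⟨L, i1, i2⟩, i3⟩ := collect_spec hA hB st.heap hsub (st.q, 0)
  rw [h.holds.elems] at i2 i3
  have hL : ∀ p, p ∈ L ↔ p ∈ allIndices A B ∧ cornerOf A B p.1 p.2 true ∈ H := by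
    rintro ⟨u, v⟩
    rw [← Multiset.mem_coe, i2, Multiset.mem_map]
    constructor
    · rintro ⟨c, hc, hi⟩
      obtain ⟨h1, h2⟩ := Multiset.mem_filter.1 hc
      obtain ⟨u', v', b, hu, hv, rfl⟩ := mem_allCorners.1 (h.holds.subset h1)
      simp only [index_cornerOf, Prod.mk.injEq, isMax_cornerOf] at hi h2
      obtain ⟨rfl, rfl⟩ := hi
      subst h2
      exact ⟨mem_allIndices.2 ⟨hu, hv⟩, h1⟩
    · rintro ⟨h1, h2⟩
      exact ⟨_, Multiset.mem_filter.2 ⟨h2, rfl⟩, rfl⟩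
  have hnd : L.Nodup := by
    rw [← Multiset.coe_nodup, i2]
    refine Multiset.Nodup.map_on ?_ (H.nodup.filter _)
    intro c hc d hd hcd
    obtain ⟨h1, h2⟩ := Multiset.mem_filter.1 hc
    obtain ⟨h3, h4⟩ := Multiset.mem_filter.1 hd
    obtain ⟨u, v, b, -, -, rfl⟩ := mem_allCorners.1 (h.holds.subset h1)
    obtain ⟨u', v', b', -, -, rfl⟩ := mem_allCorners.1 (h.holds.subset h3)
    simp at hcd h2 h4
    simp [hcd, h2, h4]
  have hcard := h.card_le
  have hc' : H.val.card = H.card := rfl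
  simp only [phase2, Cost.val_bind, Cost.steps_bind, steps_tick]
  refine ⟨⟨L ++ st.q, _, i1, ?_, ?_, ?_⟩, by omega⟩
  · refine List.nodup_append'.2 ⟨hnd, h.nodup, fun p h1 h2 => ?_⟩
    exact Finset.disjoint_left.1 h.disjoint ((h.mem_q p).1 h2).2 ((hL p).1 h1).2
  · intro p
    rw [List.mem_append, hL, h.mem_q, ← and_or_left]
    refine and_congr_right fun hp => ?_
    obtain ⟨h1, h2⟩ := mem_allIndices.1 hp
    rw [← h.max p.1 p.2 h1 h2, Finset.mem_union, or_comm]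
  · rw [List.map_append, List.sum_append, h.s_eq, zero_add, add_comm]

/-- The truncated predecessor map is at most two-to-one in each coordinate, so its fibres have at
most four points. -/
theorem sum_pred_le (S T : Finset (ℕ × ℕ)) (hST : ∀ p ∈ S, (p.1 - 1, p.2 - 1) ∈ T)
    (f : ℕ × ℕ → ℕ) : ∑ p ∈ S, f (p.1 - 1, p.2 - 1) ≤ 4 * ∑ p ∈ T, f p := by
  rw [← Finset.sum_fiberwise_of_maps_to hST, Finset.mul_sum]
  refine Finset.sum_le_sum fun y _ => ?_
  have h1 : ∀ x ∈ S.filter (fun p => (p.1 - 1, p.2 - 1) = y), f (x.1 - 1, x.2 - 1) = f y := by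
    intro x hx
    rw [(Finset.mem_filter.1 hx).2]
  rw [Finset.sum_congr rfl h1, Finset.sum_const, smul_eq_mul]
  refine Nat.mul_le_mul_right _ ?_
  have h2 : S.filter (fun p => (p.1 - 1, p.2 - 1) = y) ⊆
      ({y.1, y.1 + 1} : Finset ℕ) ×ˢ ({y.2, y.2 + 1} : Finset ℕ) := by
    rintro ⟨u, v⟩ hx
    have := (Finset.mem_filter.1 hx).2
    subst this
    simp only [Finset.mem_product, Finset.mem_insert, Finset.mem_singleton]
    omega
  refine (Finset.card_le_card h2).trans ?_
  rw [Finset.card_product]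
  exact Nat.mul_le_mul Finset.card_le_two Finset.card_le_two

/-- The layer products that are generated have `O(k)` elements. -/
theorem Invariant.sum_le (hA : OrderedLayers A) (hB : OrderedLayers B) {st : State ℝ}
    {P H : Finset (Corner ℝ)} (h : Invariant A B st P H) {k M : ℕ}
    (hst : StopsAt A B k st P) (hks : k ≤ st.s) (hk : 1 ≤ k)
    (hA0 : sizeOf A 0 = 1) (hB0 : sizeOf B 0 = 1)
    (hAM : ∀ u < A.size, sizeOf A u ≤ M * sizeOf A (u - 1))
    (hBM : ∀ v < B.size, sizeOf B v ≤ M * sizeOf B (v - 1))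
    {q : List (ℕ × ℕ)} (hq : q.Nodup)
    (hqm : ∀ p, p ∈ q ↔ p ∈ allIndices A B ∧ cornerOf A B p.1 p.2 false ∈ P) :
    (q.map (prodSizeOf A B)).sum ≤ (1 + 4 * M ^ 2) * k := by
  obtain ⟨u, v, hu, hv, hP, hlast, hs⟩ := hst.resolve_left (by omega)
  rw [h.s_eq, ← List.sum_toFinset _ h.nodup] at hs
  rw [← List.sum_toFinset _ hq]
  have huv : (u, v) ∈ st.q.toFinset := by
    rw [List.mem_toFinset, h.mem_q]
    exact ⟨mem_allIndices.2 ⟨hu, hv⟩, hP⟩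
  rw [← Finset.add_sum_erase _ _ huv] at hs
  -- The product `(0, 0)`, which is its own truncated predecessor, has just one element and is set
  -- aside.
  have h1 : ∑ p ∈ q.toFinset, prodSizeOf A B p ≤
      1 + ∑ p ∈ q.toFinset.erase (0, 0), prodSizeOf A B p := by
    by_cases h0 : ((0, 0) : ℕ × ℕ) ∈ q.toFinset
    · rw [← Finset.add_sum_erase _ _ h0]
      simp [prodSizeOf, hA0, hB0]
    · rw [Finset.erase_eq_of_notMem h0]
      omega
  have hmem : ∀ p ∈ q.toFinset.erase (0, 0), p ≠ (0, 0) ∧ p.1 < A.size ∧ p.2 < B.size ∧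
      cornerOf A B p.1 p.2 false ∈ P := by
    intro p hp
    obtain ⟨h1, h2⟩ := Finset.mem_erase.1 hp
    rw [List.mem_toFinset, hqm, mem_allIndices] at h2
    exact ⟨h1, h2.1.1, h2.1.2, h2.2⟩
  have h2 : ∑ p ∈ q.toFinset.erase (0, 0), prodSizeOf A B p ≤
      ∑ p ∈ q.toFinset.erase (0, 0), M ^ 2 * prodSizeOf A B (p.1 - 1, p.2 - 1) := by
    refine Finset.sum_le_sum fun p hp => ?_
    obtain ⟨-, h1, h2, -⟩ := hmem p hp
    calc prodSizeOf A B p ≤ (M * sizeOf A (p.1 - 1)) * (M * sizeOf B (p.2 - 1)) :=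
          Nat.mul_le_mul (hAM _ h1) (hBM _ h2)
      _ = M ^ 2 * prodSizeOf A B (p.1 - 1, p.2 - 1) := by rw [prodSizeOf]; ring
  have h3 := sum_pred_le (q.toFinset.erase (0, 0)) (st.q.toFinset.erase (u, v)) (by
    intro p hp
    obtain ⟨h0, h1, h2, h3⟩ := hmem p hp
    have hlt := cornerOf_pred_lt hA hB h1 h2 h0
    rw [Finset.mem_erase, List.mem_toFinset, h.mem_q, mem_allIndices]
    refine ⟨?_, ⟨by simp only; omega, by simp only; omega⟩, ?_⟩
    -- The last product `(u, v)` is not a predecessor here: its maximum would lie strictly below a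
    -- popped corner, although it is the largest one popped.
    · intro e
      obtain ⟨rfl, rfl⟩ := Prod.mk.injEq .. ▸ e
      exact lt_irrefl _ (hlt.trans_le (hlast _ h3))
    · exact h.mem_of_lt hA hB (mem_allCorners.2 ⟨_, _, _, by omega, by omega, rfl⟩) h3 hlt)
    (prodSizeOf A B)
  rw [← Finset.mul_sum] at h2
  -- Leaving out the last product is essential: its size alone need not be bounded by `k` directly.
  have h4 : ∑ p ∈ st.q.toFinset.erase (u, v), prodSizeOf A B p ≤ k := by omega
  nlinarith [Nat.mul_le_mul_left (M ^ 2) (h3.trans (Nat.mul_le_mul_left 4 h4))]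

end PhaseTwo

/-! ### Phase 3: generating and selecting candidates -/

section PhaseThree

variable {A B : Array (Layer ℝ)}

/-- The entries of the layer with index `u`. -/
def entriesOf (A : Array (Layer ℝ)) (u : ℕ) : List ℝ := A[u]?.elim [] Layer.entries

/-- All sums of an element of `s` and one of `t`. -/
noncomputable def msums (s t : Multiset ℝ) : Multiset ℝ := (s ×ˢ t).map fun p => p.1 + p.2

theorem msums_coe (l m : List ℝ) : msums l m = sums l m := by
  rw [msums, Multiset.coe_product, Multiset.map_coe]
  simp only [sums, SProd.sprod, List.product, List.map_flatMap, List.map_map]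
  rfl

/-- Forming all sums is biadditive in the two multisets, so decomposing both vectors into layers
decomposes `X + Y` into layer products. -/
theorem msums_sum {ι κ : Type*} (s : Finset ι) (t : Finset κ) (f : ι → Multiset ℝ)
    (g : κ → Multiset ℝ) : msums (∑ i ∈ s, f i) (∑ j ∈ t, g j) =
      ∑ p ∈ s ×ˢ t, msums (f p.1) (g p.2) := by
  classical
  rw [Finset.sum_product]
  have h1 : ∀ x, msums x (∑ j ∈ t, g j) = ∑ j ∈ t, msums x (g j) := fun x =>
    map_sum (⟨⟨fun y => msums x y, by simp [msums]⟩, fun y z => by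
      simp [msums, Multiset.product_add]⟩ : Multiset ℝ →+ Multiset ℝ) g t
  have h2 : ∀ y, msums (∑ i ∈ s, f i) y = ∑ i ∈ s, msums (f i) y := fun y =>
    map_sum (⟨⟨fun x => msums x y, by simp [msums]⟩, fun x z => by
      simp [msums, Multiset.add_product]⟩ : Multiset ℝ →+ Multiset ℝ) f s
  rw [h2]
  exact Finset.sum_congr rfl fun i _ => h1 _

theorem coe_flatMap_eq_sum {R : Type} (L : List (Layer R)) :
    ((L.flatMap Layer.entries : List R) : Multiset R) =
      ∑ u ∈ Finset.range L.length, ((L[u]?.elim [] Layer.entries : List R) : Multiset R) := by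
  induction L with
  | nil => rfl
  | cons a L ih =>
    rw [List.length_cons, Finset.sum_range_succ']
    simp only [List.getElem?_cons_succ, ← ih]
    simp [add_comm]

/-- The elements of the layer product with index `p`. -/
noncomputable def layerProduct (A B : Array (Layer ℝ)) (p : ℕ × ℕ) : Multiset ℝ :=
  (sums (entriesOf A p.1) (entriesOf B p.2) : List ℝ)

theorem length_sums (l m : List ℝ) : (sums l m).length = l.length * m.length := by
  simp [sums]

theorem length_entriesOf (A : Array (Layer ℝ)) (u : ℕ) : (entriesOf A u).length = sizeOf A u := by
  unfold entriesOf sizeOf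
  cases A[u]? <;> rfl

theorem card_layerProduct (p : ℕ × ℕ) : (layerProduct A B p).card = prodSizeOf A B p := by
  simp [layerProduct, length_sums, prodSizeOf, length_entriesOf]

theorem sums_eq_sum_layerProduct {X Y : List ℝ}
    (hA : (A.toList.flatMap Layer.entries).Perm X) (hB : (B.toList.flatMap Layer.entries).Perm Y) :
    (sums X Y : Multiset ℝ) = ∑ p ∈ allIndices A B, layerProduct A B p := by
  have h : ∀ (A : Array (Layer ℝ)) {X}, (A.toList.flatMap Layer.entries).Perm X →
      (X : Multiset ℝ) = ∑ u ∈ Finset.range A.size, (entriesOf A u : Multiset ℝ) := by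
    intro A X hA
    rw [← Multiset.coe_eq_coe.2 hA, coe_flatMap_eq_sum]
    simp [entriesOf]
  rw [← msums_coe, h A hA, h B hB, msums_sum]
  simp only [msums_coe]
  rfl

theorem addRow_spec (x : ℝ) (l acc : List ℝ) :
    (addRow x l acc).val.Perm (acc ++ l.map fun y => x + y) ∧
      (addRow x l acc).steps = l.length + 1 := by
  induction l generalizing acc with
  | nil => simp [addRow]
  | cons y t ih =>
    obtain ⟨h1, h2⟩ := ih ((x + y) :: acc)
    simp only [addRow, Cost.val_bind, Cost.steps_bind, steps_tick, h2, List.map_cons,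
      List.length_cons]
    exact ⟨h1.trans List.perm_middle.symm, by omega⟩

theorem addProduct_spec (l m acc : List ℝ) :
    (addProduct l m acc).val.Perm (acc ++ sums l m) ∧
      (addProduct l m acc).steps = l.length * (m.length + 2) + 1 := by
  induction l generalizing acc with
  | nil => simp [addProduct, sums]
  | cons x t ih =>
    obtain ⟨h1, h2⟩ := addRow_spec x m acc
    obtain ⟨h3, h4⟩ := ih (addRow x m acc).val
    simp only [addProduct, Cost.val_bind, Cost.steps_bind, steps_tick, h2, h4, List.length_cons]
    refine ⟨h3.trans ((h1.append_right _).trans ?_), by ring⟩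
    simp [sums]

/-- Non-empty layers are needed for the cost: with sizes `a, b ≥ 1`, the overhead per row and per
product is absorbed, `a * (b + 2) + 2 ≤ 5 * (a * b)`. -/
theorem candidates_spec (q : List (ℕ × ℕ)) (hq : ∀ p ∈ q, p ∈ allIndices A B)
    (hA : ∀ u < A.size, 0 < sizeOf A u) (hB : ∀ v < B.size, 0 < sizeOf B v) (acc : List ℝ) :
    ((candidates A B q acc).val : Multiset ℝ) = acc + (q.map (layerProduct A B)).sum ∧
      (candidates A B q acc).steps ≤ 5 * (q.map (prodSizeOf A B)).sum + 1 := by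
  induction q generalizing acc with
  | nil => simp [candidates]
  | cons p q ih =>
    obtain ⟨u, v⟩ := p
    obtain ⟨hu, hv⟩ := mem_allIndices.1 (hq (u, v) (by simp))
    have e1 : A[u]? = some A[u] := Array.getElem?_eq_getElem hu
    have e2 : B[v]? = some B[v] := Array.getElem?_eq_getElem hv
    obtain ⟨h1, h2⟩ := addProduct_spec A[u].entries B[v].entries acc
    obtain ⟨h3, h4⟩ := ih (fun p hp => hq p (by simp [hp]))
      (addProduct A[u].entries B[v].entries acc).val
    have hu' := hA u hu
    have hv' := hB v hv
    simp only [candidates, e1, e2, Cost.val_bind, Cost.steps_bind, steps_tick, List.map_cons,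
      List.sum_cons, h2]
    constructor
    · rw [h3, Multiset.coe_eq_coe.2 h1, ← Multiset.coe_add, add_assoc]
      simp [layerProduct, entriesOf, e1, e2]
    · have e3 : A[u].entries.length = sizeOf A u := by simp [sizeOf, e1]
      have e4 : B[v].entries.length = sizeOf B v := by simp [sizeOf, e2]
      rw [e3, e4]
      have : prodSizeOf A B (u, v) = sizeOf A u * sizeOf B v := rfl
      have : sizeOf A u * 1 ≤ sizeOf A u * sizeOf B v := Nat.mul_le_mul_left _ hv'
      nlinarith

theorem phase3_spec {q : List (ℕ × ℕ)} (hq : ∀ p ∈ q, p ∈ allIndices A B)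
    (hA : ∀ u < A.size, 0 < sizeOf A u) (hB : ∀ v < B.size, 0 < sizeOf B v) {k : ℕ}
    (hk : k ≤ (q.map (prodSizeOf A B)).sum) :
    (∃ rest : List ℝ, (((phase3 A B q k).val ++ rest : List ℝ) : Multiset ℝ) =
        (q.map (layerProduct A B)).sum ∧ (phase3 A B q k).val.length = k ∧
        ∀ a ∈ (phase3 A B q k).val, ∀ b ∈ rest, a ≤ b) ∧
      (phase3 A B q k).steps ≤ 1015 * (q.map (prodSizeOf A B)).sum + 12 := by
  obtain ⟨h1, h2⟩ := candidates_spec q hq hA hB []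
  rw [Multiset.coe_nil, zero_add] at h1
  have hlen : (candidates A B q []).val.length = (q.map (prodSizeOf A B)).sum := by
    have := congrArg Multiset.card h1
    rw [Multiset.coe_card] at this
    rw [this]
    clear * -
    induction q with
    | nil => rfl
    | cons p q ih => simp [ih, card_layerProduct]
  obtain ⟨small, large, i1, i2, i3, i4, i5⟩ := smallest_spec k (candidates A B q []).val
    (by omega)
  have e : (phase3 A B q k).val = small := by simp only [phase3, Cost.val_bind, i1, Cost.val_pure]
  rw [e]
  refine ⟨⟨large, by rw [← h1]; exact Multiset.coe_eq_coe.2 i3, i2, i4⟩, ?_⟩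
  simp only [phase3, Cost.steps_bind, steps_tick, i1, Cost.steps_pure]
  omega

end PhaseThree

/-! ### Correctness and total running time -/

section MainResults

variable {σ : ℕ → ℕ} {A B : Array (Layer ℝ)} {X Y : List ℝ}

theorem IsLOH.size_pos (hA : IsLOH σ X A) (hX : 0 < X.length) : 0 < A.size := by
  by_contra h
  have h0 : A = #[] := Array.eq_empty_of_size_eq_zero (by omega)
  have := hA.perm.length_eq
  rw [h0] at this
  simp at this
  omega

theorem IsLOH.sizeOf_eq (hA : IsLOH σ X A) {u : ℕ} (hu : u < A.size) : sizeOf A u = A[u].size := by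
  rw [(hA.describes u hu).size_eq]
  simp [sizeOf, Array.getElem?_eq_getElem hu]

theorem IsLOH.sizeOf_pos (hA : IsLOH σ X A) (u : ℕ) (hu : u < A.size) : 0 < sizeOf A u := by
  have := List.length_pos_of_mem (hA.describes u hu).lo_mem
  simpa [sizeOf, Array.getElem?_eq_getElem hu] using this

theorem IsLOH.sizeOf_zero (hA : IsLOH σ X A) (hX : 0 < X.length) (hσ : σ 0 = 1) :
    sizeOf A 0 = 1 := by
  have h := hA.size_pos hX
  have h1 := hA.sizeOf_pos 0 h
  have h2 := hA.size_le 0 h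
  rw [← hA.sizeOf_eq h] at h2
  omega

theorem IsLOH.sizeOf_le (hA : IsLOH σ X A) {M : ℕ} (hM1 : 1 ≤ M)
    (hM : ∀ u, σ (u + 1) ≤ M * σ u) (u : ℕ) (hu : u < A.size) :
    sizeOf A u ≤ M * sizeOf A (u - 1) := by
  cases u with
  | zero => exact Nat.le_mul_of_pos_left _ hM1
  | succ u =>
    rw [Nat.add_sub_cancel, hA.sizeOf_eq hu, hA.sizeOf_eq (by omega), hA.size_eq u hu]
    exact (hA.size_le _ hu).trans (hM u)

theorem IsLOH.bounds (hA : IsLOH σ X A) {u : ℕ} {x : ℝ} (hx : x ∈ entriesOf A u) :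
    loOf A u ≤ x ∧ x ≤ hiOf A u := by
  by_cases hu : u < A.size
  · have e := Array.getElem?_eq_getElem hu
    simp only [entriesOf, loOf, hiOf, e, Option.elim] at hx ⊢
    exact ⟨(hA.describes u hu).lo_le x hx, (hA.describes u hu).le_hi x hx⟩
  · have e : A[u]? = none := Array.getElem?_eq_none (not_lt.1 hu)
    simp [entriesOf, e] at hx

theorem IsLOH.orderedLayers (hA : IsLOH σ X A) (hX : 0 < X.length) (hσ : σ 0 = 1) :
    OrderedLayers A := by
  refine ⟨hA.size_pos hX, fun u v huv hv => ?_, fun u => ?_, ?_, fun u hu =>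
    (hA.describes u hu).size_eq⟩
  · have := hA.sorted u v huv hv
    simpa [hiOf, loOf, Array.getElem?_eq_getElem hv, Array.getElem?_eq_getElem (huv.trans hv)]
  · by_cases hu : u < A.size
    · have := (hA.describes u hu).lo_le _ (hA.describes u hu).hi_mem
      simpa [hiOf, loOf, Array.getElem?_eq_getElem hu]
    · have e : A[u]? = none := Array.getElem?_eq_none (not_lt.1 hu)
      simp [loOf, hiOf, e]
  · have h := hA.size_pos hX
    have h1 : A[0].entries.length = 1 := by
      rw [← (hA.describes 0 h).size_eq, ← hA.sizeOf_eq h, hA.sizeOf_zero hX hσ]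
    obtain ⟨x, hx⟩ := List.length_eq_one_iff.1 h1
    have h2 := (hA.describes 0 h).lo_mem
    have h3 := (hA.describes 0 h).hi_mem
    rw [hx, List.mem_singleton] at h2 h3
    simp [loOf, hiOf, Array.getElem?_eq_getElem h, h2, h3]

theorem mem_layerProduct (hA : IsLOH σ X A) (hB : IsLOH σ Y B) {p : ℕ × ℕ} {z : ℝ}
    (hz : z ∈ layerProduct A B p) :
    loOf A p.1 + loOf B p.2 ≤ z ∧ z ≤ hiOf A p.1 + hiOf B p.2 := by
  simp only [layerProduct, sums, Multiset.mem_coe, List.mem_flatMap, List.mem_map] at hz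
  obtain ⟨x, hx, y, hy, rfl⟩ := hz
  have h1 := hA.bounds hx
  have h2 := hB.bounds hy
  exact ⟨add_le_add h1.1 h2.1, add_le_add h1.2 h2.2⟩

/-- If the elements outside a multiset are at least `T`, and at least `k` of those inside are at
most `T`, then the `k` smallest elements of the multiset are at most `T`. -/
theorem forall_le_of_countP {k : ℕ} {T : ℝ} {out rest : List ℝ} {S : Multiset ℝ}
    (hlen : out.length = k) (hle : ∀ a ∈ out, ∀ b ∈ rest, a ≤ b)
    (hS : S ≤ ((out ++ rest : List ℝ) : Multiset ℝ)) (hT : ∀ a ∈ S, a ≤ T)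
    (hk : k ≤ S.card) : ∀ a ∈ out, a ≤ T := by
  intro a ha
  by_contra hn
  have h1 : S.card ≤ (out ++ rest).countP (· ≤ T) := by
    rw [← Multiset.countP_eq_card.2 hT, ← Multiset.coe_countP]
    exact Multiset.countP_le_of_le _ hS
  rw [List.countP_append] at h1
  have h2 : rest.countP (· ≤ T) = 0 := by
    rw [List.countP_eq_zero]
    intro b hb hbT
    exact hn ((hle a ha b hb).trans (by simpa using hbT))
  have h3 : out.countP (· ≤ T) ≠ out.length := by
    rw [Ne, List.countP_eq_length]
    intro h
    exact hn (by simpa using h a ha)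
  have h4 : out.countP (· ≤ T) ≤ out.length := List.countP_le_length
  omega

/-- The value of the last popped corner separates the output from all sums that were never
generated. -/
theorem Invariant.isTopK (hA : IsLOH σ X A) (hB : IsLOH σ Y B) (hA' : OrderedLayers A)
    (hB' : OrderedLayers B) {st : State ℝ} {P H : Finset (Corner ℝ)} (h : Invariant A B st P H)
    {k : ℕ} (hst : StopsAt A B k st P) (hks : k ≤ st.s) {q : List (ℕ × ℕ)} (hq : q.Nodup)
    (hqm : ∀ p, p ∈ q ↔ p ∈ allIndices A B ∧ cornerOf A B p.1 p.2 false ∈ P)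
    {out rest : List ℝ} (hout : out.length = k)
    (hsum : ((out ++ rest : List ℝ) : Multiset ℝ) = (q.map (layerProduct A B)).sum)
    (hle : ∀ a ∈ out, ∀ b ∈ rest, a ≤ b) : IsTopK k X Y out := by
  obtain ⟨u, v, hu, hv, hP, hlast, -⟩ := hst.resolve_left (by omega)
  rw [← List.sum_toFinset _ hq] at hsum
  have hsub : q.toFinset ⊆ allIndices A B := fun p hp =>
    ((hqm p).1 (List.mem_toFinset.1 hp)).1
  have hsub' : st.q.toFinset ⊆ q.toFinset := by
    intro p hp
    rw [List.mem_toFinset, h.mem_q] at hp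
    obtain ⟨h1, h2⟩ := mem_allIndices.1 hp.1
    rw [List.mem_toFinset, hqm]
    exact ⟨hp.1, (h.max _ _ h1 h2).1 (Finset.mem_union_left _ hp.2)⟩
  -- The products counted in phase 1 already contain `k` sums up to this threshold, since their
  -- maxima were popped no later than the last corner.
  have hT : ∀ a ∈ out, a ≤ hiOf A u + hiOf B v := by
    refine forall_le_of_countP (S := ∑ p ∈ st.q.toFinset, layerProduct A B p) hout hle ?_ ?_ ?_
    · rw [hsum]
      exact Finset.sum_le_sum_of_subset hsub'
    · intro a ha
      obtain ⟨p, hp, hap⟩ := Multiset.mem_sum.1 ha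
      rw [List.mem_toFinset, h.mem_q] at hp
      refine (mem_layerProduct hA hB hap).2.trans ?_
      have := value_le_of_corner_le (hlast _ hp.2)
      simpa using this
    · rw [Multiset.card_sum]
      simp only [card_layerProduct]
      rw [List.sum_toFinset _ h.nodup, ← h.s_eq]
      exact hks
  refine ⟨hout, rest ++ (∑ p ∈ allIndices A B \ q.toFinset, layerProduct A B p).toList, ?_, ?_⟩
  · rw [← Multiset.coe_eq_coe, sums_eq_sum_layerProduct hA.perm hB.perm, ← Finset.sum_sdiff hsub,
      ← hsum, ← List.append_assoc, ← Multiset.coe_add, Multiset.coe_toList, add_comm]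
  · intro a ha b hb
    rcases List.mem_append.1 hb with hb | hb
    · exact hle a ha b hb
    · rw [Multiset.mem_toList, Multiset.mem_sum] at hb
      obtain ⟨p, hp, hbp⟩ := hb
      obtain ⟨h1, h2⟩ := Finset.mem_sdiff.1 hp
      rw [List.mem_toFinset, hqm] at h2
      obtain ⟨h3, h4⟩ := mem_allIndices.1 h1
      -- An omitted product has an unpopped minimum; some heap corner lies between the last popped
      -- corner and it, so its sums reach at least the threshold.
      obtain ⟨d, hd, hdp⟩ := h.exists_le hA' hB' (c := cornerOf A B p.1 p.2 false)
        (mem_allCorners.2 ⟨_, _, _, h3, h4, rfl⟩) (fun h' => h2 ⟨h1, h'⟩)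
      have := value_le_of_corner_le ((h.lt _ hP d hd).le.trans hdp)
      simp only [if_true, Bool.false_eq_true, if_false] at this
      exact (hT a ha).trans (this.trans (mem_layerProduct hA hB hbp).1)

theorem phases_spec (hσ0 : σ 0 = 1) {M : ℕ} (hM1 : 1 ≤ M) (hM : ∀ u, σ (u + 1) ≤ M * σ u)
    (hA : IsLOH σ X A) (hB : IsLOH σ Y B) {k : ℕ} (hk1 : 1 ≤ k)
    (hk : k ≤ X.length * Y.length) {st : State ℝ} {q : List (ℕ × ℕ)} {s' : ℕ}
    (hst : (phase1 A B k).val = st) (hq : (phase2 A B st).val = (q, s')) :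
    IsTopK k X Y (phase3 A B q k).val ∧ st.corners ≤ 2 * A.size * B.size ∧ k ≤ st.s ∧
      totalSize A B st.q = st.s ∧ totalSize A B q = st.s + s' ∧
      st.s + s' ≤ (1 + 4 * M ^ 2) * k ∧
      (phase3 A B q k).steps ≤ 1027 * (1 + 4 * M ^ 2) * k ∧
      (phase1 A B k).steps + (phase2 A B st).steps ≤ 30 * (2 * A.size * B.size + 1) ^ 2 := by
  have hX : 0 < X.length := Nat.pos_of_ne_zero fun h => by rw [h, zero_mul] at hk; omega
  have hY : 0 < Y.length := Nat.pos_of_ne_zero fun h => by rw [h, mul_zero] at hk; omega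
  have hA' := hA.orderedLayers hX hσ0
  have hB' := hB.orderedLayers hY hσ0
  have htot : ∑ p ∈ allIndices A B, prodSizeOf A B p = X.length * Y.length := by
    have := congrArg Multiset.card (sums_eq_sum_layerProduct hA.perm hB.perm)
    rw [Multiset.coe_card, length_sums, Multiset.card_sum] at this
    simpa only [card_layerProduct] using this.symm
  obtain ⟨⟨P, H, hI, hlast, hks⟩, t1⟩ := phase1_spec hA' hB' hk1 (hk.trans htot.ge)
  rw [hst] at hI hlast hks
  obtain ⟨⟨q1, s1, e, hnd, hqm, hsum⟩, t2⟩ := phase2_spec hA' hB' hI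
  obtain ⟨rfl, rfl⟩ := Prod.mk.injEq .. ▸ hq.symm.trans e
  have hC := hI.sum_le hA' hB' hlast hks hk1 (hA.sizeOf_zero hX hσ0) (hB.sizeOf_zero hY hσ0)
    (hA.sizeOf_le hM1 hM) (hB.sizeOf_le hM1 hM) hnd hqm
  obtain ⟨⟨rest, r1, r2, r3⟩, t3⟩ := phase3_spec (fun p hp => ((hqm p).1 hp).1) hA.sizeOf_pos
    hB.sizeOf_pos (k := k) (q := q) (by omega)
  have hcorn := hI.card_le
  have hce := hI.corners_eq
  refine ⟨hI.isTopK hA hB hA' hB' hlast hks hnd hqm r2 r1 r3, by omega, hks, hI.s_eq.symm, hsum,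
    by omega, ?_, ?_⟩
  · rw [mul_assoc]
    generalize (1 + 4 * M ^ 2) * k = D at *
    omega
  · generalize 2 * A.size * B.size = D at *
    nlinarith

/-- Apply `log y ≤ y - 1` to the eighth root of `x`, so that the fourth power leaves `√x`; the
constant is `8 ^ 4`. The exponent four arises because the time is quadratic in a product of two
logarithms. -/
theorem one_add_log_pow_four_le {x : ℝ} (hx : 1 ≤ x) :
    (1 + Real.log x) ^ 4 ≤ 4096 * √x := by
  have h0 : 0 ≤ x := by linarith
  have h1 : Real.log √(√(√x)) = Real.log x / 8 := by
    rw [Real.log_sqrt (by positivity), Real.log_sqrt (by positivity), Real.log_sqrt h0]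
    ring
  have hpos : 0 < √(√(√x)) := by positivity
  have h2 := Real.log_le_sub_one_of_pos hpos
  have h3 : √(√(√x)) ^ 4 = √x := by
    rw [show (4 : ℕ) = 2 * 2 from rfl, pow_mul, Real.sq_sqrt (by positivity),
      Real.sq_sqrt (by positivity)]
  have h4 : 1 + Real.log x ≤ 8 * √(√(√x)) := by rw [h1] at h2; linarith
  calc (1 + Real.log x) ^ 4 ≤ (8 * √(√(√x))) ^ 4 :=
        pow_le_pow_left₀ (by linarith [Real.log_nonneg hx]) h4 4
    _ = 4096 * √x := by rw [mul_pow, h3]; norm_num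

theorem two_mul_size_le {L : ℝ} (hL1 : 1 ≤ L)
    (hL : ∀ m n : ℕ, 1 ≤ n → (m = 0 ∨ layerStart σ (m - 1) < n) →
      (m : ℝ) ≤ L * (1 + Real.log n))
    (hA : IsLOH σ X A) (hB : IsLOH σ Y B) (hX : 1 ≤ X.length) (hY : 1 ≤ Y.length) :
    ((2 * A.size * B.size : ℕ) : ℝ) ≤
        2 * L ^ 2 * (1 + Real.log X.length) * (1 + Real.log Y.length) ∧
      ((30 * (2 * A.size * B.size + 1) ^ 2 : ℕ) : ℝ) ≤
        30 * 9 * L ^ 4 * (4096 * √(X.length + Y.length)) := by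
  have h1 := hL A.size X.length hX hA.start_lt
  have h2 := hL B.size Y.length hY hB.start_lt
  have h3 : 0 ≤ Real.log X.length := Real.log_natCast_nonneg _
  have h4 : 0 ≤ Real.log Y.length := Real.log_natCast_nonneg _
  have hX' : (1 : ℝ) ≤ X.length := by exact_mod_cast hX
  have hY' : (1 : ℝ) ≤ Y.length := by exact_mod_cast hY
  have h5 : (A.size : ℝ) * B.size ≤
      (L * (1 + Real.log X.length)) * (L * (1 + Real.log Y.length)) :=
    mul_le_mul h1 h2 (Nat.cast_nonneg _) (by positivity)
  have h6 : ((2 * A.size * B.size : ℕ) : ℝ) ≤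
      2 * L ^ 2 * (1 + Real.log X.length) * (1 + Real.log Y.length) := by
    push_cast
    nlinarith
  refine ⟨h6, ?_⟩
  set z := 1 + Real.log (X.length + Y.length : ℝ) with hz
  have h7 : 1 + Real.log X.length ≤ z := by
    rw [hz]
    linarith [Real.log_le_log (by linarith) (show (X.length : ℝ) ≤ X.length + Y.length by linarith)]
  have h8 : 1 + Real.log Y.length ≤ z := by
    rw [hz]
    linarith [Real.log_le_log (by linarith) (show (Y.length : ℝ) ≤ X.length + Y.length by linarith)]
  have hz1 : 1 ≤ z := by linarith
  have h9 : (1 + Real.log X.length) * (1 + Real.log Y.length) ≤ z * z :=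
    mul_le_mul h7 h8 (by positivity) (by linarith)
  have h10 : (1 : ℝ) ≤ L ^ 2 * (z * z) := by nlinarith [one_le_pow₀ hL1 (n := 2), mul_self_nonneg z]
  have h11 : ((2 * A.size * B.size + 1 : ℕ) : ℝ) ≤ 3 * (L ^ 2 * (z * z)) := by
    rw [Nat.cast_add, Nat.cast_one]
    have := mul_le_mul_of_nonneg_left h9 (show 0 ≤ 2 * L ^ 2 by positivity)
    linarith
  have h12 := one_add_log_pow_four_le (x := X.length + Y.length) (by linarith)
  rw [← hz] at h12
  have h13 := pow_le_pow_left₀ (Nat.cast_nonneg _) h11 2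
  rw [Nat.cast_mul, Nat.cast_pow]
  calc ((30 : ℕ) : ℝ) * ((2 * A.size * B.size + 1 : ℕ) : ℝ) ^ 2
      ≤ 30 * (3 * (L ^ 2 * (z * z))) ^ 2 := by
        push_cast at h13 ⊢
        linarith
    _ = 30 * 9 * L ^ 4 * z ^ 4 := by ring
    _ ≤ _ := mul_le_mul_of_nonneg_left h12 (by positivity)

end MainResults

end LOH

open LOH in
theorem mainTheorem1 (α : ℝ) (hα : 1 < α) (σ : ℕ → ℕ) (hσ : IsLayerSizes α σ) :
    (∃ C : ℝ, ∀ (X Y : List ℝ) (k : ℕ), 1 ≤ k → k ≤ X.length * Y.length →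
      ∀ (A B : Array (Layer ℝ)) (st : State ℝ) (q : List (ℕ × ℕ)) (s' : ℕ),
        (phase0 σ X Y).val = (A, B) →
        (phase1 A B k).val = st →
        (phase2 A B st).val = (q, s') →
          -- the algorithm returns the `k` smallest values, in total time `O(n + k)`
          IsTopK k X Y (topK σ X Y k).val ∧
          ((topK σ X Y k).steps : ℝ) ≤ C * (X.length + Y.length + k) ∧
          -- phase 0 takes time `O(n)`
          ((phase0 σ X Y).steps : ℝ) ≤ C * (X.length + Y.length) ∧
          -- phases 1 and 2 handle polylogarithmically many corners
          (st.corners : ℝ) ≤ C * (1 + Real.log X.length) * (1 + Real.log Y.length) ∧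
          -- the layer products in `q` have `s + s'` elements, which is `O(k)`
          k ≤ st.s ∧
          totalSize A B st.q = st.s ∧
          totalSize A B q = st.s + s' ∧
          ((st.s + s' : ℕ) : ℝ) ≤ C * k ∧
          -- phase 3 takes time `O(k)`
          ((phase3 A B q k).steps : ℝ) ≤ C * k) ∧
    -- phases 1 and 2 take time `o(n)`
    (∀ ε : ℝ, 0 < ε → ∃ N : ℕ, ∀ (X Y : List ℝ) (k : ℕ), 1 ≤ k → k ≤ X.length * Y.length →
      N ≤ X.length + Y.length →
      ∀ (A B : Array (Layer ℝ)) (st : State ℝ),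
        (phase0 σ X Y).val = (A, B) →
        (phase1 A B k).val = st →
          (((phase1 A B k).steps + (phase2 A B st).steps : ℕ) : ℝ) ≤
            ε * (X.length + Y.length)) := by
  obtain ⟨M, hM1, hM⟩ := hσ.exists_succ_le
  obtain ⟨L, hL1, hL⟩ := hσ.exists_size_le_log hα
  obtain ⟨K, hK⟩ := phase0_steps_le (R := ℝ) hα hσ
  have pos : ∀ {X Y : List ℝ} {k : ℕ}, 1 ≤ k → k ≤ X.length * Y.length →
      1 ≤ X.length ∧ 1 ≤ Y.length := fun {X Y k} h1 h2 => by
    constructor <;> refine Nat.pos_of_ne_zero fun h => ?_ <;> simp [h] at h2 <;> omega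
  have loh : ∀ {X Y : List ℝ} {A B : Array (Layer ℝ)}, (phase0 σ X Y).val = (A, B) →
      IsLOH σ X A ∧ IsLOH σ Y B := fun {X Y A B} h => by
    obtain ⟨rfl, rfl⟩ := Prod.mk.injEq .. ▸ h
    exact ⟨(lohify_spec hσ.pos X).1, (lohify_spec hσ.pos Y).1⟩
  constructor
  · set D := 1 + 4 * M ^ 2 with hD
    set E : ℝ := 30 * 9 * L ^ 4 * 4096 with hE
    have hL0 : 0 ≤ L := by linarith
    have hE0 : 0 ≤ E := by positivity
    -- One summand per source: the call itself, phase 0, phases 1 and 2, phase 3 (which also covers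
    -- the candidates), and the number of corners.
    refine ⟨1 + K + E + 1027 * D + 2 * L ^ 2, fun X Y k hk1 hk A B st q s' h0 h1 h2 => ?_⟩
    obtain ⟨hX, hY⟩ := pos hk1 hk
    obtain ⟨hA, hB⟩ := loh h0
    obtain ⟨p1, p2, p3, p4, p5, p6, p7, p8⟩ := phases_spec hσ.first hM1 hM hA hB hk1 hk h1 h2
    obtain ⟨b1, b2⟩ := two_mul_size_le hL1 hL hA hB hX hY
    have t0 := hK X Y hX hY
    have hval : (topK σ X Y k).val = (phase3 A B q k).val := by
      simp only [topK, Cost.val_bind, h0, h1, h2]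
    have hsteps : (topK σ X Y k).steps = 1 + (phase0 σ X Y).steps +
        ((phase1 A B k).steps + (phase2 A B st).steps) + (phase3 A B q k).steps := by
      simp only [topK, Cost.steps_bind, steps_tick, h0, h1, h2]
      ring
    have hX' : (1 : ℝ) ≤ X.length := by exact_mod_cast hX
    have hY' : (1 : ℝ) ≤ Y.length := by exact_mod_cast hY
    have hk' : (1 : ℝ) ≤ k := by exact_mod_cast hk1
    set n : ℝ := X.length + Y.length with hn
    have hn1 : 1 ≤ n := by linarith
    have hsqrt : √n ≤ n := Real.sqrt_le_iff.2 ⟨by linarith, by nlinarith⟩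
    have t0' : ((phase0 σ X Y).steps : ℝ) ≤ K * n := by rw [hn]; exact_mod_cast t0
    have t12 : (((phase1 A B k).steps + (phase2 A B st).steps : ℕ) : ℝ) ≤ E * n := by
      refine (Nat.cast_le.2 p8).trans (b2.trans ?_)
      rw [hE, ← mul_assoc]
      exact mul_le_mul_of_nonneg_left hsqrt hE0
    have t3 : ((phase3 A B q k).steps : ℝ) ≤ 1027 * D * k := by exact_mod_cast p7
    have hK0 : (0 : ℝ) ≤ K := Nat.cast_nonneg K
    have hD0 : (0 : ℝ) ≤ D := Nat.cast_nonneg D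
    have hl1 : 0 ≤ Real.log X.length := Real.log_natCast_nonneg _
    have hl2 : 0 ≤ Real.log Y.length := Real.log_natCast_nonneg _
    have mono : ∀ {c x : ℝ}, 0 ≤ x → c ≤ 1 + K + E + 1027 * D + 2 * L ^ 2 →
        c * x ≤ (1 + K + E + 1027 * D + 2 * L ^ 2) * x :=
      fun hx hc => mul_le_mul_of_nonneg_right hc hx
    have hLL : 0 ≤ 2 * L ^ 2 := by positivity
    refine ⟨hval ▸ p1, ?_, ?_, ?_, p3, p4, p5, ?_, ?_⟩
    · rw [hsteps, Nat.cast_add, Nat.cast_add, Nat.cast_add, Nat.cast_one]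
      have m1 := mono (c := 1 + K + E) (x := n) (by linarith) (by linarith)
      have m2 := mono (c := 1027 * D) (x := k) (by linarith) (by linarith)
      linarith
    · exact t0'.trans (mono (by linarith) (by linarith))
    · refine (Nat.cast_le.2 p2).trans (b1.trans ?_)
      rw [mul_assoc, mul_assoc (1 + K + E + 1027 * D + 2 * L ^ 2)]
      exact mono (by positivity) (by linarith)
    · have : ((st.s + s' : ℕ) : ℝ) ≤ D * k := by exact_mod_cast p6
      exact this.trans (mono (by linarith) (by linarith))
    · exact t3.trans (mono (by linarith) (by linarith))
  · intro ε hε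
    have hL0 : 0 ≤ L := by linarith
    set E : ℝ := 30 * 9 * L ^ 4 * 4096 with hE
    have hE0 : 0 ≤ E := by positivity
    -- Phases 1 and 2 take at most `E * √n` steps, where `n` is the total length; this is at most `ε
    -- * n` once `√n ≥ E / ε`.
    refine ⟨⌈(E / ε) ^ 2⌉₊, fun X Y k hk1 hk hN A B st h0 h1 => ?_⟩
    obtain ⟨hX, hY⟩ := pos hk1 hk
    obtain ⟨hA, hB⟩ := loh h0
    obtain ⟨-, -, -, -, -, -, -, p8⟩ := phases_spec hσ.first hM1 hM hA hB hk1 hk h1 rfl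
    obtain ⟨-, b2⟩ := two_mul_size_le hL1 hL hA hB hX hY
    refine (Nat.cast_le.2 p8).trans (b2.trans ?_)
    have hn : (E / ε) ^ 2 ≤ X.length + Y.length := by
      refine (Nat.le_ceil _).trans ?_
      exact_mod_cast hN
    have hn0 : (0 : ℝ) ≤ X.length + Y.length := by positivity
    have h2 : E / ε ≤ √(X.length + Y.length) := Real.le_sqrt_of_sq_le hn
    rw [div_le_iff₀ hε] at h2
    calc 30 * 9 * L ^ 4 * (4096 * √(X.length + Y.length))
        = E * √(X.length + Y.length) := by rw [hE]; ring
      _ ≤ √(X.length + Y.length) * ε * √(X.length + Y.length) :=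
          mul_le_mul_of_nonneg_right h2 (Real.sqrt_nonneg _)
      _ = ε * (√(X.length + Y.length) * √(X.length + Y.length)) := by ring
      _ = ε * (X.length + Y.length) := by rw [Real.mul_self_sqrt hn0]
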